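/- Let $M=\bigoplus_{i\in\mathbb Z}\mathbb Z b_i$, let $\bigwedge M$ be its exterior algebra, and let $\sigma_+(z):\bigwedge M\to\bigwedge M[[z]]$ and $\sigma_-(z),\overline\sigma_-(z):\bigwedge M\to\bigwedge M[[z^{-1}]]$ be the unital multiplicative $\mathbb Z$-linear maps (Hasse--Schmidt derivations) with $\sigma_\pm(z)b_j=\sum_{i\ge0}b_{j\pm i}z^{\pm i}$ and $\overline\sigma_-(z)b_j=b_j-b_{j-1}z^{-1}$. Let $[M]$ be the free abelian group on symbols $[\mathbf b]_m$, $m\in\mathbb Z$, and let the fermionic Fock space $F$ be the quotient of $\bigwedge M\otimes_{\mathbb Z}[M]$ by the $\bigwedge M$-submodule generated by all $b_m\otimes[\mathbf b]_{m-1}-1\otimes[\mathbf b]_m$ and $b_m\otimes[\mathbf b]_m$; write $u\wedge[\mathbf b]_m$ for the class of $u\otimes[\mathbf b]_m$. For a partition $\lambda=(\lambda_1\ge\dots\ge\lambda_r\ge0)$ put $[\mathbf b]_{m+\lambda}=b_{m+\lambda_1}\wedge b_{m-1+\lambda_2}\wedge\dots\wedge b_{m-r+1+\lambda_r}\wedge[\mathbf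 b]_{m-r}$. Extend the three maps additively to $F$ by $D(z)(u\wedge[\mathbf b]_m)=D(z)u\wedge D(z)[\mathbf b]_m$, where $\sigma_+(z)[\mathbf b]_m=\sigma_+(z)b_m\wedge[\mathbf b]_{m-1}$ and $\sigma_-(z)[\mathbf b]_m=\overline\sigma_-(z)[\mathbf b]_m=[\mathbf b]_m$, and write $\sigma_+(z)=\sum_{n\ge0}\sigma_nz^n$ on $F$. Let $B=\mathbb Z[e_1,e_2,\dots]$, $E(z)=1+\sum_{j\ge1}(-1)^je_jz^j$, and let $H=(h_n)_{n\in\mathbb Z}$ be given by $\sum_{n\in\mathbb Z}h_nz^n=1/E(z)$ (so $h_n=0$ for $n<0$ and $h_0=1$). Let $B$ act on $F$ by letting $h_n$ act as $\sigma_n$ ($n\ge0$). For a sequence $a=(a_n)_{n\in\mathbb Z}$ in a commutative ring and $\lambda$ as above, with $r$ parts (some possibly $0$), let $\Delta_\lambda(a)=\det(a_{\lambda_j-j+i})_{1\le i,j\le r}$. **Theorem.** There are unique $\mathbb Z$-linear maps $\overline\sigma_-(z),\sigma_-(z):B\to B[z^{-1}]$ such that, for every partition $\lambda$, $$(\overline\sigma_-(z)\Delta_\lambda(H))[\mathbf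 b]_0=\overline\sigma_-(z)(\Delta_\lambda(H)[\mathbf b]_0)=\overline\sigma_-(z)[\mathbf b]_{0+\lambda},\qquad (\sigma_-(z)\Delta_\lambda(H))[\mathbf b]_0=\sigma_-(z)(\Delta_\lambda(H)[\mathbf b]_0)=\sigma_-(z)[\mathbf b]_{0+\lambda}.$$ They satisfy, for all $n\in\mathbb Z$, $$\overline\sigma_-(z)h_n=h_n-h_{n-1}z^{-1},\qquad \sigma_-(z)h_n=\sum_{j\ge0}h_{n-j}z^{-j},$$ and, with $\overline\sigma_-(z)H=(\overline\sigma_-(z)h_n)_{n\in\mathbb Z}$ and $\sigma_-(z)H=(\sigma_-(z)h_n)_{n\in\mathbb Z}$, for every partition $\lambda$, $$\overline\sigma_-(z)\Delta_\lambda(H)=\Delta_\lambda(\overline\sigma_-(z)H),\qquad \sigma_-(z)\Delta_\lambda(H)=\Delta_\lambda(\sigma_-(z)H).$$ Moreover $\overline\sigma_-(z)$ and $\sigma_-(z)$ are ring homomorphisms $B\to B[z^{-1}]$ whose coefficient of $z^0$ is the identity of $B$, that is, they are Hasse--Schmidt derivations on $B$. -/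

import Mathlib

open scoped Polynomial TensorProduct PowerSeries

noncomputable section

namespace SchubertFock

/-! ### The module `M`, its exterior algebra and the Schubert derivations -/

/-- The free abelian group `M` with basis `(b i)`, `i ∈ ℤ`. -/
abbrev FreeM : Type := ℤ →₀ ℤ

/-- The basis element `b_i` of `M`. -/
def b (i : ℤ) : FreeM := Finsupp.single i 1

/-- The exterior algebra `⋀ M`. -/
abbrev ExtM : Type := ExteriorAlgebra ℤ FreeM

/-- The element `b_i` of `⋀ M`. -/
def eb (i : ℤ) : ExtM := ExteriorAlgebra.ι ℤ (b i)

/-- The endomorphism `b_j ↦ b_{j + k}` of `M`. -/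
def shift (k : ℤ) : FreeM →ₗ[ℤ] FreeM := Finsupp.lmapDomain ℤ ℤ (fun j => j + k)

theorem shift_b (k j : ℤ) : shift k (b j) = b (j + k) := by
  simp [shift, b]

/-- The map `u ↦ ∑ i, φ_i(u) t ^ i` from `M` to `(⋀ M)⟦t⟧`. -/
def seriesOnM (φ : ℕ → FreeM →ₗ[ℤ] FreeM) : FreeM →ₗ[ℤ] PowerSeries ExtM where
  toFun u := PowerSeries.mk fun i => ExteriorAlgebra.ι ℤ (φ i u)
  map_add' u v := by ext i; simp
  map_smul' c u := by
    ext i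
    rw [RingHom.id_apply, ← LinearMap.toAddMonoidHom_coe, map_zsmul]
    simp

theorem eb_ι_anticomm (u v : FreeM) :
    ExteriorAlgebra.ι ℤ u * ExteriorAlgebra.ι ℤ v
      + ExteriorAlgebra.ι ℤ v * ExteriorAlgebra.ι ℤ u = 0 :=
  ExteriorAlgebra.ι_add_mul_swap u v

theorem seriesOnM_sq (φ : ℕ → FreeM →ₗ[ℤ] FreeM) (u : FreeM) :
    seriesOnM φ u * seriesOnM φ u = 0 := by
  ext n
  rw [PowerSeries.coeff_mul]
  simp only [seriesOnM, LinearMap.coe_mk, AddHom.coe_mk, PowerSeries.coeff_mk, map_zero]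
  refine Finset.sum_involution (fun p _ => p.swap) ?_ ?_ ?_ ?_
  · intro p _
    exact eb_ι_anticomm _ _
  · rintro ⟨i, j⟩ _ h0 h
    apply h0
    simp only [Prod.swap_prod_mk, Prod.mk.injEq] at h
    obtain ⟨rfl, -⟩ := h
    exact ExteriorAlgebra.ι_sq_zero _
  · intro p hp
    simpa [add_comm] using hp
  · intro p _
    simp

/-- The Hasse-Schmidt derivation `⋀ M → (⋀ M)⟦t⟧` (a multiplicative map) which extends the map
`u ↦ ∑ i, φ_i(u) t ^ i` on `M`. -/
def hsDerivation (φ : ℕ → FreeM →ₗ[ℤ] FreeM) : ExtM →ₐ[ℤ] PowerSeries ExtM :=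
  ExteriorAlgebra.lift ℤ ⟨seriesOnM φ, seriesOnM_sq φ⟩

theorem coeff_hsDerivation_ι (φ : ℕ → FreeM →ₗ[ℤ] FreeM) (u : FreeM) (n : ℕ) :
    PowerSeries.coeff n (hsDerivation φ (ExteriorAlgebra.ι ℤ u))
      = ExteriorAlgebra.ι ℤ (φ n u) := by
  have h : hsDerivation φ (ExteriorAlgebra.ι ℤ u) = seriesOnM φ u :=
    ExteriorAlgebra.lift_ι_apply ℤ _ _ u
  rw [h]
  simp [seriesOnM]

/-- `σ₊(z)` on `⋀ M`, with `t = z`: `σ₊(z) b_j = ∑_{i ≥ 0} b_{j+i} z^i`. -/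
def sigmaPlus : ExtM →ₐ[ℤ] PowerSeries ExtM := hsDerivation fun i => shift (i : ℤ)

/-- `σ₋(z)` on `⋀ M`, with `t = z⁻¹`: `σ₋(z) b_j = ∑_{i ≥ 0} b_{j-i} z^{-i}`. -/
def sigmaMinus : ExtM →ₐ[ℤ] PowerSeries ExtM := hsDerivation fun i => shift (-(i : ℤ))

/-- `σ̄₋(z)` on `⋀ M`, with `t = z⁻¹`: `σ̄₋(z) b_j = b_j - b_{j-1} z^{-1}`. -/
def sigmaBarMinus : ExtM →ₐ[ℤ] PowerSeries ExtM :=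
  hsDerivation fun i => if i = 0 then LinearMap.id else if i = 1 then -shift (-1) else 0

theorem coeff_sigmaPlus (j : ℤ) (n : ℕ) :
    PowerSeries.coeff n (sigmaPlus (eb j)) = eb (j + n) := by
  simp [sigmaPlus, eb, coeff_hsDerivation_ι, shift_b]

theorem coeff_sigmaMinus (j : ℤ) (n : ℕ) :
    PowerSeries.coeff n (sigmaMinus (eb j)) = eb (j - n) := by
  simp [sigmaMinus, eb, coeff_hsDerivation_ι, shift_b, sub_eq_add_neg]

theorem coeff_sigmaBarMinus (j : ℤ) (n : ℕ) :
    PowerSeries.coeff n (sigmaBarMinus (eb j))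
      = if n = 0 then eb j else if n = 1 then -eb (j - 1) else 0 := by
  rw [sigmaBarMinus, eb, coeff_hsDerivation_ι]
  split_ifs <;> simp [shift_b, eb, sub_eq_add_neg]

/-! ### The fermionic Fock space -/

/-- The free abelian group `[M]` with basis `([b]_m)`, `m ∈ ℤ`. -/
abbrev VacM : Type := ℤ →₀ ℤ

/-- The submodule `W` of `⋀ M ⊗ [M]` generated over `⋀ M` by the elements
`b_m ⊗ [b]_{m-1} - 1 ⊗ [b]_m` and `b_m ⊗ [b]_m`. -/
def fockRel : Submodule ExtM (ExtM ⊗[ℤ] VacM) :=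
  Submodule.span ExtM
    (Set.range (fun m : ℤ => eb m ⊗ₜ[ℤ] (Finsupp.single (m - 1) 1 : VacM)
        - (1 : ExtM) ⊗ₜ[ℤ] (Finsupp.single m 1 : VacM))
      ∪ Set.range (fun m : ℤ => eb m ⊗ₜ[ℤ] (Finsupp.single m 1 : VacM)))

/-- The fermionic Fock space `F = (⋀ M ⊗ [M]) / W`. -/
def Fock : Type := (ExtM ⊗[ℤ] VacM) ⧸ fockRel

instance : AddCommGroup Fock := inferInstanceAs (AddCommGroup ((ExtM ⊗[ℤ] VacM) ⧸ fockRel))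

instance : Module ExtM Fock := inferInstanceAs (Module ExtM ((ExtM ⊗[ℤ] VacM) ⧸ fockRel))

/-- The canonical projection `⋀ M ⊗ [M] → F`. -/
def toFock : (ExtM ⊗[ℤ] VacM) →ₗ[ExtM] Fock := fockRel.mkQ

/-- The element `[b]_m` of `F`. The element `u ∧ [b]_m` is then `u • vac m`. -/
def vac (m : ℤ) : Fock := toFock ((1 : ExtM) ⊗ₜ[ℤ] (Finsupp.single m 1 : VacM))

/-- `[b]_{m+λ} = b_{m+λ_1} ∧ b_{m-1+λ_2} ∧ ⋯ ∧ b_{m-r+1+λ_r} ∧ [b]_{m-r}`, where the partition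
`λ` of length at most `r` is given by its first `r` parts. -/
def fockBasis (m : ℤ) {r : ℕ} (lam : Fin r → ℕ) : Fock :=
  ExteriorAlgebra.ιMulti ℤ r (fun i : Fin r => b (m - (i : ℕ) + lam i)) • vac (m - r)

theorem toFock_tmul_single (u : ExtM) (m : ℤ) :
    toFock (u ⊗ₜ[ℤ] (Finsupp.single m 1 : VacM)) = u • vac m := by
  rw [vac, ← map_smul, TensorProduct.smul_tmul', smul_eq_mul, mul_one]

theorem eb_smul_vac_pred (m : ℤ) : eb m • vac (m - 1) = vac m := by
  rw [← toFock_tmul_single, vac, ← sub_eq_zero, ← map_sub]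
  exact (Submodule.Quotient.mk_eq_zero _).2 (Submodule.subset_span (Or.inl ⟨m, rfl⟩))

theorem eb_mul_self (m : ℤ) : eb m * eb m = 0 := ExteriorAlgebra.ι_sq_zero _

theorem eb_mul_swap (i j : ℤ) : eb i * eb j = -(eb j * eb i) :=
  eq_neg_of_add_eq_zero_left (eb_ι_anticomm _ _)

theorem eb_smul_vac_add (j : ℤ) (k : ℕ) : eb j • vac (j + k) = 0 := by
  induction k with
  | zero =>
    rw [Nat.cast_zero, add_zero, ← eb_smul_vac_pred, smul_smul, eb_mul_self, zero_smul]
  | succ k ih =>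
    rw [← eb_smul_vac_pred (j + (k + 1 : ℕ)), smul_smul, eb_mul_swap, neg_smul, ← smul_smul,
      show j + ((k + 1 : ℕ) : ℤ) - 1 = j + k by push_cast; ring, ih, smul_zero, neg_zero]

theorem eb_smul_vac_of_le {j m : ℤ} (h : j ≤ m) : eb j • vac m = 0 := by
  obtain ⟨k, rfl⟩ := Int.le.dest h
  exact eb_smul_vac_add j k

theorem fock_induction {p : Fock → Prop} (hv : ∀ (u : ExtM) (m : ℤ), p (u • vac m))
    (hadd : ∀ x y, p x → p y → p (x + y)) (x : Fock) : p x := by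
  obtain ⟨y, rfl⟩ := Submodule.mkQ_surjective fockRel x
  have h0 : p 0 := by
    have h := hv 0 0
    rwa [zero_smul] at h
  induction y with
  | zero => rw [map_zero]; exact h0
  | add y z hy hz => rw [map_add]; exact hadd _ _ hy hz
  | tmul u s =>
    induction s using Finsupp.induction_linear with
    | zero => rw [TensorProduct.tmul_zero, map_zero]; exact h0
    | add f g hf hg => rw [TensorProduct.tmul_add, map_add]; exact hadd _ _ hf hg
    | single m c =>
      have : u ⊗ₜ[ℤ] (Finsupp.single m c : VacM)
          = (c • u) ⊗ₜ[ℤ] (Finsupp.single m 1 : VacM) := by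
        rw [TensorProduct.smul_tmul]; simp
      rw [this]
      have h := hv (c • u) m
      rw [← toFock_tmul_single] at h
      exact h

/-! ### Formal power series with coefficients in `F` and the extension of derivations to `F` -/

/-- The product in `F⟦t⟧` (sequences of coefficients in `F`) of an element of `(⋀ M)⟦t⟧` and an
element of `F⟦t⟧`. -/
def wedgeSeries (A : PowerSeries ExtM) (x : ℕ → Fock) : ℕ → Fock := fun n =>
  ∑ p ∈ Finset.HasAntidiagonal.antidiagonal n, PowerSeries.coeff p.1 A • x p.2

/-- The constant series with value `v`. -/
def constSeries (v : Fock) : ℕ → Fock := fun n => if n = 0 then v else 0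

theorem wedgeSeries_add_left (A B : PowerSeries ExtM) (x : ℕ → Fock) :
    wedgeSeries (A + B) x = wedgeSeries A x + wedgeSeries B x := by
  funext n
  simp [wedgeSeries, add_smul, Finset.sum_add_distrib]

theorem wedgeSeries_zero_left (x : ℕ → Fock) : wedgeSeries 0 x = 0 := by
  funext n
  simp [wedgeSeries]

theorem wedgeSeries_add_right (A : PowerSeries ExtM) (x y : ℕ → Fock) :
    wedgeSeries A (x + y) = wedgeSeries A x + wedgeSeries A y := by
  funext n
  simp [wedgeSeries, smul_add, Finset.sum_add_distrib]

theorem wedgeSeries_const (A : PowerSeries ExtM) (v : Fock) (n : ℕ) :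
    wedgeSeries A (constSeries v) n = PowerSeries.coeff n A • v := by
  rw [wedgeSeries, Finset.sum_eq_single (n, 0)]
  · simp [constSeries]
  · rintro ⟨i, j⟩ hp hne
    have : j ≠ 0 := by
      rintro rfl
      apply hne
      simpa using hp
    simp [constSeries, this]
  · simp

theorem wedgeSeries_mul (A B : PowerSeries ExtM) (x : ℕ → Fock) :
    wedgeSeries (A * B) x = wedgeSeries A (wedgeSeries B x) := by
  funext n
  simp only [wedgeSeries, PowerSeries.coeff_mul, Finset.sum_smul, Finset.smul_sum, smul_smul,
    Finset.sum_sigma']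
  refine Finset.sum_nbij' (fun p => ⟨(p.2.1, p.2.2 + p.1.2), (p.2.2, p.1.2)⟩)
    (fun p => ⟨(p.1.1 + p.2.1, p.2.2), (p.1.1, p.2.1)⟩) ?_ ?_ ?_ ?_ ?_
  all_goals
    rintro ⟨⟨i, j⟩, ⟨k, l⟩⟩ h
    simp only [Finset.mem_sigma, Finset.HasAntidiagonal.mem_antidiagonal] at h ⊢
    try grind

/-- The map `x ↦ D(z)u ∧ x` from `F⟦t⟧` to itself, as a function of `u ∈ ⋀ M`. -/
def wedgeSeriesHom (D : ExtM →ₐ[ℤ] PowerSeries ExtM) (x : ℕ → Fock) :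
    ExtM →ₗ[ℤ] (ℕ → Fock) :=
  AddMonoidHom.toIntLinearMap
    { toFun := fun u => wedgeSeries (D u) x
      map_zero' := by rw [map_zero, wedgeSeries_zero_left]
      map_add' := fun u v => by rw [map_add, wedgeSeries_add_left] }

/-- The additive map `⋀ M ⊗ [M] → F⟦t⟧` with `u ⊗ [b]_m ↦ D(z)u ∧ v_m`. -/
def extendAux (D : ExtM →ₐ[ℤ] PowerSeries ExtM) (v : ℤ → ℕ → Fock) :
    (ExtM ⊗[ℤ] VacM) →ₗ[ℤ] (ℕ → Fock) :=
  TensorProduct.lift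
    (Finsupp.lift (ExtM →ₗ[ℤ] (ℕ → Fock)) ℤ ℤ (fun m => wedgeSeriesHom D (v m))).flip

theorem extendAux_tmul (D : ExtM →ₐ[ℤ] PowerSeries ExtM) (v : ℤ → ℕ → Fock)
    (u : ExtM) (m : ℤ) :
    extendAux D v (u ⊗ₜ[ℤ] (Finsupp.single m 1 : VacM)) = wedgeSeries (D u) (v m) := by
  have h1 : extendAux D v (u ⊗ₜ[ℤ] (Finsupp.single m 1 : VacM))
      = (Finsupp.lift (ExtM →ₗ[ℤ] (ℕ → Fock)) ℤ ℤ (fun m => wedgeSeriesHom D (v m)))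
        (Finsupp.single m 1) u := TensorProduct.lift.tmul _ _
  have h2 : (Finsupp.lift (ExtM →ₗ[ℤ] (ℕ → Fock)) ℤ ℤ (fun m => wedgeSeriesHom D (v m)))
        (Finsupp.single m 1) = wedgeSeriesHom D (v m) := by simp
  rw [h1, h2]
  rfl

theorem extendAux_smul (D : ExtM →ₐ[ℤ] PowerSeries ExtM) (v : ℤ → ℕ → Fock)
    (u : ExtM) (x : ExtM ⊗[ℤ] VacM) :
    extendAux D v (u • x) = wedgeSeries (D u) (extendAux D v x) := by
  have hadd : ∀ x y : ExtM ⊗[ℤ] VacM,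
      extendAux D v (u • x) = wedgeSeries (D u) (extendAux D v x) →
      extendAux D v (u • y) = wedgeSeries (D u) (extendAux D v y) →
      extendAux D v (u • (x + y)) = wedgeSeries (D u) (extendAux D v (x + y)) := by
    intro x y hx hy
    rw [smul_add, map_add, hx, hy, map_add, wedgeSeries_add_right]
  have h0 : extendAux D v (u • (0 : ExtM ⊗[ℤ] VacM))
      = wedgeSeries (D u) (extendAux D v 0) := by
    rw [smul_zero, map_zero]
    funext n
    simp [wedgeSeries]
  induction x with
  | zero => exact h0
  | add x y hx hy => exact hadd x y hx hy
  | tmul w s =>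
    induction s using Finsupp.induction_linear with
    | zero => rw [TensorProduct.tmul_zero]; exact h0
    | add f g hf hg => rw [TensorProduct.tmul_add]; exact hadd _ _ hf hg
    | single m c =>
      have : w ⊗ₜ[ℤ] (Finsupp.single m c : VacM)
          = (c • w) ⊗ₜ[ℤ] (Finsupp.single m 1 : VacM) := by
        rw [TensorProduct.smul_tmul]; simp
      rw [this, TensorProduct.smul_tmul', smul_eq_mul, extendAux_tmul, extendAux_tmul, map_mul,
        wedgeSeries_mul]

theorem extendAux_eq_zero (D : ExtM →ₐ[ℤ] PowerSeries ExtM) (v : ℤ → ℕ → Fock)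
    (hv : ∀ m, v m = wedgeSeries (D (eb m)) (v (m - 1))) (x : ExtM ⊗[ℤ] VacM)
    (hx : x ∈ fockRel) : extendAux D v x = 0 := by
  induction hx using Submodule.span_induction with
  | mem x hx =>
    rcases hx with ⟨m, rfl⟩ | ⟨m, rfl⟩
    · simp only [map_sub, extendAux_tmul]
      rw [← hv, hv m, ← wedgeSeries_mul, ← map_mul, one_mul, sub_self]
    · simp only [extendAux_tmul]
      rw [hv m, ← wedgeSeries_mul, ← map_mul, eb_mul_self, map_zero, wedgeSeries_zero_left]
  | zero => exact map_zero _
  | add x y _ _ hx hy => rw [map_add, hx, hy, add_zero]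
  | smul u x _ hx =>
    rw [extendAux_smul, hx]
    funext n
    simp [wedgeSeries]

/-- The extension of a Hasse-Schmidt derivation `D(z)` on `⋀ M` to the additive map
`F → F⟦t⟧` with `D(z)(u ∧ [b]_m) = D(z)u ∧ v_m`, where `v_m = D(z)[b]_m` are prescribed series
compatible with the relations `b_m ∧ [b]_{m-1} = [b]_m`. -/
def extendFock (D : ExtM →ₐ[ℤ] PowerSeries ExtM) (v : ℤ → ℕ → Fock)
    (hv : ∀ m, v m = wedgeSeries (D (eb m)) (v (m - 1))) : Fock →+ (ℕ → Fock) :=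
  QuotientAddGroup.lift fockRel.toAddSubgroup (extendAux D v).toAddMonoidHom
    (extendAux_eq_zero D v hv)

theorem extendFock_smul_vac (D : ExtM →ₐ[ℤ] PowerSeries ExtM) (v : ℤ → ℕ → Fock)
    (hv : ∀ m, v m = wedgeSeries (D (eb m)) (v (m - 1))) (u : ExtM) (m : ℤ) :
    extendFock D v hv (u • vac m) = wedgeSeries (D u) (v m) := by
  rw [← toFock_tmul_single, ← extendAux_tmul]
  rfl

theorem extendFock_smul (D : ExtM →ₐ[ℤ] PowerSeries ExtM) (v : ℤ → ℕ → Fock)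
    (hv : ∀ m, v m = wedgeSeries (D (eb m)) (v (m - 1))) (u : ExtM) (x : Fock) :
    extendFock D v hv (u • x) = wedgeSeries (D u) (extendFock D v hv x) := by
  induction x using fock_induction with
  | hv w m => rw [smul_smul, extendFock_smul_vac, extendFock_smul_vac, map_mul, wedgeSeries_mul]
  | hadd x y hx hy => rw [smul_add, map_add, hx, hy, map_add, wedgeSeries_add_right]

theorem sigmaPlus_compat (m : ℤ) :
    wedgeSeries (sigmaPlus (eb m)) (constSeries (vac (m - 1)))
      = wedgeSeries (sigmaPlus (eb m))
        (wedgeSeries (sigmaPlus (eb (m - 1))) (constSeries (vac (m - 1 - 1)))) := by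
  have h : sigmaPlus (eb (m - 1))
      = PowerSeries.C (eb (m - 1)) + PowerSeries.X * sigmaPlus (eb m) := by
    ext n
    rcases n with _ | n
    · simp [coeff_sigmaPlus]
    · simp only [coeff_sigmaPlus, map_add, PowerSeries.coeff_C, PowerSeries.coeff_succ_X_mul]
      simp only [Nat.add_eq_zero_iff, one_ne_zero, and_false, if_false, zero_add]
      congr 1
      push_cast
      ring
  rw [← wedgeSeries_mul, h, mul_add, ← mul_assoc, (PowerSeries.commute_X (sigmaPlus (eb m))).eq, mul_assoc,
    ← map_mul sigmaPlus, eb_mul_self, map_zero, mul_zero, add_zero, wedgeSeries_mul]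
  congr 1
  funext n
  rw [wedgeSeries_const, PowerSeries.coeff_C, constSeries]
  split_ifs
  · rw [eb_smul_vac_pred]
  · rw [zero_smul]

theorem sigmaMinus_compat (m : ℤ) :
    constSeries (vac m) = wedgeSeries (sigmaMinus (eb m)) (constSeries (vac (m - 1))) := by
  funext n
  rw [wedgeSeries_const, coeff_sigmaMinus, constSeries]
  split_ifs with h
  · subst h
    rw [Nat.cast_zero, sub_zero, eb_smul_vac_pred]
  · rw [eb_smul_vac_of_le (by omega)]

theorem sigmaBarMinus_compat (m : ℤ) :
    constSeries (vac m) = wedgeSeries (sigmaBarMinus (eb m)) (constSeries (vac (m - 1))) := by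
  funext n
  rw [wedgeSeries_const, coeff_sigmaBarMinus, constSeries]
  split_ifs with h h'
  · rw [eb_smul_vac_pred]
  · rw [neg_smul, eb_smul_vac_of_le le_rfl, neg_zero]
  · rw [zero_smul]

/-- `σ₊(z)` on `F`, determined by `σ₊(z)[b]_m = σ₊(z)b_m ∧ [b]_{m-1}`. -/
def sigmaPlusFock : Fock →+ (ℕ → Fock) :=
  extendFock sigmaPlus (fun m => wedgeSeries (sigmaPlus (eb m)) (constSeries (vac (m - 1))))
    sigmaPlus_compat

/-- `σ₋(z)` on `F`, determined by `σ₋(z)[b]_m = [b]_m`; the `n`-th term is the coefficient of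
`z^{-n}`. -/
def sigmaMinusFock : Fock →+ (ℕ → Fock) :=
  extendFock sigmaMinus (fun m => constSeries (vac m)) sigmaMinus_compat

/-- `σ̄₋(z)` on `F`, determined by `σ̄₋(z)[b]_m = [b]_m`; the `n`-th term is the coefficient of
`z^{-n}`. -/
def sigmaBarMinusFock : Fock →+ (ℕ → Fock) :=
  extendFock sigmaBarMinus (fun m => constSeries (vac m)) sigmaBarMinus_compat

/-! ### The action of the ring `B` on `F` -/

/-- The operator `σ_n` on `F`, `n ≥ 0`: the coefficient of `z^n` in `σ₊(z)`. -/
def sigmaOp (n : ℕ) : Module.End ℤ Fock :=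
  AddMonoidHom.toIntLinearMap ((Pi.evalAddMonoidHom (fun _ : ℕ => Fock) n).comp sigmaPlusFock)

theorem sigmaOp_smul (n : ℕ) (u : ExtM) (x : Fock) :
    sigmaOp n (u • x) = ∑ p ∈ Finset.HasAntidiagonal.antidiagonal n,
      PowerSeries.coeff p.1 (sigmaPlus u) • sigmaOp p.2 x :=
  congrFun (extendFock_smul sigmaPlus _ sigmaPlus_compat u x) n

theorem sigmaOp_vac (n : ℕ) (m : ℤ) : sigmaOp n (vac m) = eb (m + n) • vac (m - 1) := by
  have h : sigmaOp n (vac m) = wedgeSeries (sigmaPlus 1)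
      (wedgeSeries (sigmaPlus (eb m)) (constSeries (vac (m - 1)))) n := by
    have h := extendFock_smul_vac sigmaPlus _ sigmaPlus_compat 1 m
    rw [one_smul] at h
    exact congrFun h n
  rw [h, ← wedgeSeries_mul, ← map_mul, one_mul, wedgeSeries_const, coeff_sigmaPlus]

theorem coeff_sigmaPlus_comm (u : ExtM) : ∀ i j : ℕ,
    PowerSeries.coeff i (sigmaPlus (PowerSeries.coeff j (sigmaPlus u)))
      = PowerSeries.coeff j (sigmaPlus (PowerSeries.coeff i (sigmaPlus u))) := by
  induction u using ExteriorAlgebra.induction with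
  | algebraMap r =>
    intro i j
    rw [Algebra.algebraMap_eq_smul_one]
    simp only [map_zsmul, map_one, PowerSeries.coeff_one]
    split_ifs <;> simp [PowerSeries.coeff_one, *]
  | ι x =>
    intro i j
    simp only [sigmaPlus, coeff_hsDerivation_ι]
    congr 1
    induction x using Finsupp.induction_linear with
    | zero => simp
    | add f g hf hg => simp only [map_add, hf, hg]
    | single m c => simp [shift, add_right_comm]
  | add u v hu hv =>
    intro i j
    simp only [map_add, hu i j, hv i j]
  | mul u v hu hv =>
    intro i j
    simp only [map_mul, PowerSeries.coeff_mul, map_sum]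
    rw [Finset.sum_comm]
    refine Finset.sum_congr rfl fun p _ => Finset.sum_congr rfl fun q _ => ?_
    rw [hu, hv]

theorem sum_eb_eb_eq_zero (x : ℤ) (d : ℕ) (w : Fock) :
    ∑ k ∈ Finset.range d, eb (x + k) • eb (x + (d - 1 - k)) • w = 0 := by
  refine Finset.sum_involution (fun k _ => d - 1 - k) ?_ ?_ ?_ ?_
  · intro k hk
    have hk : k < d := Finset.mem_range.1 hk
    have h1 : ((d - 1 - k : ℕ) : ℤ) = d - 1 - k := by omega
    rw [h1, smul_smul, smul_smul, ← add_smul, sub_sub_cancel]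
    have := eb_ι_anticomm (b (x + k)) (b (x + (d - 1 - k)))
    simp only [eb]
    rw [this, zero_smul]
  · intro k hk h0 h
    have hk : k < d := Finset.mem_range.1 hk
    have h1 : (d : ℤ) - 1 - k = k := by omega
    apply h0
    rw [h1, smul_smul, eb_mul_self, zero_smul]
  · intro k hk
    have hk : k < d := Finset.mem_range.1 hk
    exact Finset.mem_range.2 (by omega)
  · intro k hk
    have hk : k < d := Finset.mem_range.1 hk
    change d - 1 - (d - 1 - k) = k
    omega

theorem sigmaOp_sigmaOp_vac (i j : ℕ) (m : ℤ) :
    sigmaOp i (sigmaOp j (vac m))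
      = ∑ k ∈ Finset.range (i + 1), eb (m + j + k) • eb (m - 1 + (i - k)) • vac (m - 1 - 1) := by
  rw [sigmaOp_vac, sigmaOp_smul, Finset.Nat.sum_antidiagonal_eq_sum_range_succ
    (fun a c => PowerSeries.coeff a (sigmaPlus (eb (m + j))) • sigmaOp c (vac (m - 1)))]
  refine Finset.sum_congr rfl fun k hk => ?_
  have hk := Finset.mem_range.1 hk
  have h1 : ((i - k : ℕ) : ℤ) = i - k := by omega
  rw [coeff_sigmaPlus, sigmaOp_vac, h1]

theorem sigmaOp_comm_vac_aux (i d : ℕ) (m : ℤ) :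
    sigmaOp (i + d) (sigmaOp i (vac m)) = sigmaOp i (sigmaOp (i + d) (vac m)) := by
  rw [sigmaOp_sigmaOp_vac, sigmaOp_sigmaOp_vac, show i + d + 1 = d + (i + 1) by omega,
    Finset.sum_range_add]
  have h := sum_eb_eb_eq_zero (m + i) d (vac (m - 1 - 1))
  refine (congrArg₂ (· + ·) ?_ ?_).trans (zero_add _)
  · rw [← h]
    refine Finset.sum_congr rfl fun k _ => ?_
    congr 3
    push_cast
    ring
  · refine Finset.sum_congr rfl fun k _ => ?_
    congr 2
    · push_cast; ring_nf
    · congr 1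
      push_cast; ring

theorem sigmaOp_comm_vac (i j : ℕ) (m : ℤ) :
    sigmaOp i (sigmaOp j (vac m)) = sigmaOp j (sigmaOp i (vac m)) := by
  rcases le_total i j with h | h
  · obtain ⟨d, rfl⟩ := Nat.exists_eq_add_of_le h
    exact (sigmaOp_comm_vac_aux i d m).symm
  · obtain ⟨d, rfl⟩ := Nat.exists_eq_add_of_le h
    exact sigmaOp_comm_vac_aux j d m

theorem sigmaOp_comm (i j : ℕ) : sigmaOp i * sigmaOp j = sigmaOp j * sigmaOp i := by
  refine LinearMap.ext fun x => ?_
  rw [Module.End.mul_apply, Module.End.mul_apply]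
  induction x using fock_induction with
  | hv u m =>
    simp only [sigmaOp_smul, map_sum]
    rw [Finset.sum_comm]
    refine Finset.sum_congr rfl fun p _ => Finset.sum_congr rfl fun q _ => ?_
    rw [coeff_sigmaPlus_comm, sigmaOp_comm_vac]
  | hadd x y hx hy => simp only [map_add, hx, hy]

theorem sigmaOp_zero : sigmaOp 0 = 1 := by
  refine LinearMap.ext fun x => ?_
  rw [Module.End.one_apply]
  have h0 : ∀ u : ExtM, PowerSeries.coeff 0 (sigmaPlus u) = u := by
    intro u
    induction u using ExteriorAlgebra.induction with
    | algebraMap r =>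
      rw [Algebra.algebraMap_eq_smul_one]
      simp only [map_zsmul, map_one, PowerSeries.coeff_one, if_true]
    | ι x =>
      simp only [sigmaPlus, coeff_hsDerivation_ι]
      congr 1
      induction x using Finsupp.induction_linear with
      | zero => simp
      | add f g hf hg => simp only [map_add, hf, hg]
      | single m c => simp [shift]
    | add u v hu hv => simp only [map_add, hu, hv]
    | mul u v hu hv =>
      simp only [map_mul, PowerSeries.coeff_mul]
      simp [hu, hv]
  induction x using fock_induction with
  | hv u m =>
    rw [sigmaOp_smul]
    simp [h0, sigmaOp_vac, eb_smul_vac_pred]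
  | hadd x y hx hy => simp only [map_add, hx, hy]

/-- The commutative ring of operators on `F` generated by the `σ_n`, `n ≥ 0`. -/
def OpRing : Subalgebra ℤ (Module.End ℤ Fock) := Algebra.adjoin ℤ (Set.range sigmaOp)

theorem opRing_comm : IsMulCommutative OpRing :=
  Algebra.isMulCommutative_adjoin ℤ (by
    rintro _ ⟨i, rfl⟩ _ ⟨j, rfl⟩
    exact sigmaOp_comm i j)

instance : CommRing OpRing :=
  { OpRing.toRing with mul_comm := opRing_comm.is_comm.comm }

/-- The series `∑ σ_n z^n`. -/
def opSeries : PowerSeries OpRing :=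
  PowerSeries.mk fun n => ⟨sigmaOp n, Algebra.subset_adjoin ⟨n, rfl⟩⟩

/-- The polynomial ring `B = ℤ[e_1, e_2, …]`; the indeterminate `e_{k+1}` is `X k`. -/
abbrev B : Type := MvPolynomial ℕ ℤ

/-- `E(z) = 1 - e_1 z + e_2 z^2 - ⋯`. -/
def E : PowerSeries B :=
  PowerSeries.mk fun n => if n = 0 then 1 else (-1) ^ n * MvPolynomial.X (n - 1)

/-- The sequence `H = (h_n)`, `n ∈ ℤ`: `h_n` is the coefficient of `z^n` in `1 / E(z)`. -/
def h (n : ℤ) : B := if 0 ≤ n then PowerSeries.coeff n.toNat (PowerSeries.invOfUnit E 1) else 0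

/-- The action of `B` on `F`: the ring homomorphism which maps `E(z)` to the inverse of
`∑ σ_n z^n`, that is, which maps `h_n` to `σ_n` for all `n ≥ 0` (see `bosonAction_h`). -/
def bosonAction : B →+* Module.End ℤ Fock :=
  OpRing.val.toRingHom.comp
    (MvPolynomial.eval₂Hom (Int.castRingHom OpRing) fun k =>
      (-1) ^ (k + 1) * PowerSeries.coeff (k + 1) (PowerSeries.invOfUnit opSeries 1))

theorem bosonAction_h (n : ℕ) : bosonAction (h n) = sigmaOp n := by
  set φ : B →+* OpRing := MvPolynomial.eval₂Hom (Int.castRingHom OpRing) fun k =>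
      (-1) ^ (k + 1) * PowerSeries.coeff (k + 1) (PowerSeries.invOfUnit opSeries 1) with hφ
  have hX : ∀ k, φ (MvPolynomial.X k)
      = (-1) ^ (k + 1) * PowerSeries.coeff (k + 1) (PowerSeries.invOfUnit opSeries 1) :=
    fun k => MvPolynomial.eval₂Hom_X' _ _ k
  have h0 : PowerSeries.constantCoeff opSeries = ((1 : OpRingˣ) : OpRing) := by
    rw [← PowerSeries.coeff_zero_eq_constantCoeff_apply, opSeries, PowerSeries.coeff_mk]
    exact Subtype.ext sigmaOp_zero
  have hE0 : PowerSeries.constantCoeff E = ((1 : Bˣ) : B) := by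
    rw [← PowerSeries.coeff_zero_eq_constantCoeff_apply, E, PowerSeries.coeff_mk]
    simp
  have hE : PowerSeries.map φ E = PowerSeries.invOfUnit opSeries 1 := by
    ext1 k
    rcases k with _ | k
    · simp [E]
    · rw [PowerSeries.coeff_map, E, PowerSeries.coeff_mk, if_neg (Nat.succ_ne_zero k), map_mul,
        map_pow, map_neg, map_one, Nat.add_sub_cancel, hX, ← mul_assoc, ← mul_pow]
      simp
  have hH : PowerSeries.map φ (PowerSeries.invOfUnit E 1) = opSeries := by
    have h1 : PowerSeries.map φ E * PowerSeries.map φ (PowerSeries.invOfUnit E 1) = 1 := by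
      rw [← map_mul, PowerSeries.mul_invOfUnit E 1 hE0, map_one]
    rw [hE] at h1
    have h2 : PowerSeries.invOfUnit opSeries 1 * opSeries = 1 :=
      PowerSeries.invOfUnit_mul opSeries 1 h0
    exact (left_inv_eq_right_inv ((mul_comm _ _).trans h2) h1).symm
  have h2 := congrArg (PowerSeries.coeff n) hH
  rw [PowerSeries.coeff_map, opSeries, PowerSeries.coeff_mk] at h2
  have h3 : h n = PowerSeries.coeff n (PowerSeries.invOfUnit E 1) := by simp [h]
  rw [h3]
  exact congrArg Subtype.val h2

/-! ### Schur determinants and the maps induced on `B` -/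

/-- The Schur determinant `Δ_λ(a) = det(a_{λ_j - j + i})`, `1 ≤ i, j ≤ r`, of a sequence
`a = (a_n)`, `n ∈ ℤ`, where the partition `λ` of length at most `r` is given by its first `r`
parts. -/
def schurDet {R : Type*} [CommRing R] (a : ℤ → R) {r : ℕ} (lam : Fin r → ℕ) : R :=
  Matrix.det (Matrix.of fun i j : Fin r => a ((lam j : ℤ) - (j : ℕ) + (i : ℕ)))

/-- The product `p · [b]_0` in `F⟦z⁻¹⟧` of a polynomial `p ∈ B[z⁻¹]` and `[b]_0`. -/
def mulVac (p : B[X]) : ℕ → Fock := fun n => bosonAction (p.coeff n) (vac 0)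

/-- `S : B → B[z⁻¹]` is the `ℤ`-linear map induced by `T : F → F⟦z⁻¹⟧` through the boson-fermion
correspondence:
`(S Δ_λ(H)) [b]_0 = T(Δ_λ(H) [b]_0) = T([b]_{0+λ})` for all partitions `λ`. -/
def IsInduced (T : Fock →+ (ℕ → Fock)) (S : B →ₗ[ℤ] B[X]) : Prop :=
  ∀ (r : ℕ) (lam : Fin r → ℕ), Antitone lam →
    mulVac (S (schurDet h lam)) = T (bosonAction (schurDet h lam) (vac 0)) ∧
    T (bosonAction (schurDet h lam) (vac 0)) = T (fockBasis 0 lam)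

/-- `S : B → B[z⁻¹]` is a Hasse-Schmidt derivation on `B`: a ring homomorphism whose
coefficient of `z⁰` is the identity. -/
def IsHasseSchmidt (S : B →ₗ[ℤ] B[X]) : Prop :=
  S 1 = 1 ∧ (∀ f g : B, S (f * g) = S f * S g) ∧ ∀ f : B, (S f).coeff 0 = f

end SchubertFock

end

noncomputable section

namespace SchubertFock

/-! ### The complete symmetric functions -/

/-! Write `t = z⁻¹`. The maps on `B` are built directly as ring homomorphisms: `barHom` sends the
series `H(w)` to `H(w)(1 - tw)` and `minusHom` sends it to `H(w)/(1 - tw)`. The formulas for `h_n`,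
the compatibility with determinants and the Hasse-Schmidt property are then immediate, and it
remains to show that these maps are induced by the operators on `F` and that an induced map is
unique.

Existence. On `F` one has `h_n b_i = b_i h_n + h_{n-1} b_{i+1}`, where `b_i` stands for wedging with
`b_i`. A derivation `T` with `b_i ↦ ∑ c_k b_{i-k} t^k` that fixes every vacuum, and a ring
homomorphism `S` with `h_n ↦ ∑ c_k h_{n-k} t^k` and the same `c_k`, both respect this relation.
Since `F` is generated from the vacuums by wedging, `T ∘ h_n = S(h_n) T`
(`operatorSeries_mul_bosonAction_h`), and multiplicativity gives `T ∘ p = S(p) T` for all `p`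
(`mulVac_eq_extendFock`).

The equality `Δ_λ(H)[b]_0 = [b]_{0+λ}` comes from vertex operators: wedging with `b_j` on
`B[b]_{m-1}` becomes an explicit operator on `B` (`eb_smul_bosonAction_vac`), which adds a column to
a determinant in the `h_n` (`vertex_hDet`).

Uniqueness. The Schur determinants span `B` (`span_schurDet`), and `p ↦ p[b]_0` is injective because
a determinantal functional on `F` recovers `p` (`readoutFock_bosonAction_vac`). -/

/-- The generating series `H(w) = 1 / E(w)`. -/
def hSeries : PowerSeries B := PowerSeries.invOfUnit E 1

theorem coeff_hSeries (n : ℕ) : PowerSeries.coeff n hSeries = h n := by simp [h, hSeries]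

theorem E_mul_hSeries : E * hSeries = 1 := by
  refine PowerSeries.mul_invOfUnit E 1 ?_
  rw [← PowerSeries.coeff_zero_eq_constantCoeff_apply, E, PowerSeries.coeff_mk]
  simp

theorem coeff_zero_E : PowerSeries.coeff 0 E = 1 := by simp [E]

theorem coeff_succ_E (k : ℕ) :
    PowerSeries.coeff (k + 1) E = (-1) ^ (k + 1) * MvPolynomial.X k := by simp [E]

theorem h_of_neg {n : ℤ} (hn : n < 0) : h n = 0 := by simp [h, not_le.2 hn]

theorem h_zero : h 0 = 1 := by
  have h1 := congrArg (PowerSeries.coeff 0) E_mul_hSeries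
  rw [PowerSeries.coeff_mul] at h1
  simpa [coeff_zero_E, -PowerSeries.coeff_zero_eq_constantCoeff, coeff_hSeries] using h1

/-- The relation `E H = 1` with `h_0 = 1` expresses each `e_k` recursively through the `h_n` and
earlier `e_i`. -/
theorem adjoin_range_h : Algebra.adjoin ℤ (Set.range h) = ⊤ := by
  have hE : ∀ k : ℕ, PowerSeries.coeff k E ∈ Algebra.adjoin ℤ (Set.range h) := by
    intro k
    induction k using Nat.strong_induction_on with
    | _ k ih =>
      rcases k with _ | k
      · rw [coeff_zero_E]
        exact one_mem _
      · have h1 := congrArg (PowerSeries.coeff (k + 1)) E_mul_hSeries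
        -- The term split off is `E_{k+1} h_0`; all the others involve `E_i` with `i ≤ k`.
        rw [PowerSeries.coeff_mul, Finset.Nat.antidiagonal_succ', Finset.sum_cons,
          coeff_hSeries, Nat.cast_zero, h_zero, mul_one, PowerSeries.coeff_one,
          if_neg (Nat.succ_ne_zero k)] at h1
        rw [eq_neg_of_add_eq_zero_left h1]
        refine neg_mem (sum_mem fun p hp => ?_)
        obtain ⟨q, hq, rfl⟩ := Finset.mem_map.1 hp
        have hq' := Finset.HasAntidiagonal.mem_antidiagonal.1 hq
        refine mul_mem (ih _ ?_) ?_
        · change q.1 < k + 1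
          omega
        · rw [coeff_hSeries]
          exact Algebra.subset_adjoin ⟨_, rfl⟩
  rw [eq_top_iff, ← MvPolynomial.adjoin_range_X, Algebra.adjoin_le_iff]
  rintro _ ⟨k, rfl⟩
  have h1 := hE (k + 1)
  rw [coeff_succ_E] at h1
  have h2 : (MvPolynomial.X k : B) = (-1) ^ (k + 1) * ((-1) ^ (k + 1) * MvPolynomial.X k) := by
    rw [← mul_assoc, ← mul_pow]
    simp
  rw [h2]
  exact mul_mem (pow_mem (neg_mem (one_mem _)) _) h1

theorem boson_induction {p : B → Prop} (hh : ∀ n, p (h n)) (hint : ∀ c : ℤ, p (c : B))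
    (hadd : ∀ f g, p f → p g → p (f + g)) (hmul : ∀ f g, p f → p g → p (f * g)) (f : B) :
    p f := by
  have hf : f ∈ Algebra.adjoin ℤ (Set.range h) := by rw [adjoin_range_h]; trivial
  induction hf using Algebra.adjoin_induction with
  | mem x hx =>
    obtain ⟨n, rfl⟩ := hx
    exact hh n
  | algebraMap r => simpa using hint r
  | add x y _ _ hx hy => exact hadd x y hx hy
  | mul x y _ _ hx hy => exact hmul x y hx hy

/-! ### Ring homomorphisms `B → B[t]` -/

/-- The ring homomorphism `B → B[t]` which maps `E(w)` to `E(w) G(w)`. -/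
def twist (G : PowerSeries B[X]) : B →+* B[X] :=
  MvPolynomial.eval₂Hom (Int.castRingHom B[X]) fun k =>
    (-1) ^ (k + 1) * PowerSeries.coeff (k + 1) (PowerSeries.map Polynomial.C E * G)

theorem map_twist_E {G : PowerSeries B[X]} (hG : PowerSeries.coeff 0 G = 1) :
    PowerSeries.map (twist G) E = PowerSeries.map Polynomial.C E * G := by
  ext1 k
  rw [PowerSeries.coeff_map]
  rcases k with _ | k
  · rw [coeff_zero_E, map_one, PowerSeries.coeff_mul]
    simp [-PowerSeries.coeff_zero_eq_constantCoeff, coeff_zero_E, hG]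
  · rw [coeff_succ_E, map_mul, map_pow, map_neg, map_one, twist, MvPolynomial.eval₂Hom_X',
      ← mul_assoc, ← mul_pow]
    norm_num

theorem map_twist_hSeries {G G' : PowerSeries B[X]} (hG : PowerSeries.coeff 0 G = 1)
    (hGG' : G * G' = 1) :
    PowerSeries.map (twist G) hSeries = PowerSeries.map Polynomial.C hSeries * G' := by
  have h1 : PowerSeries.map (twist G) E * PowerSeries.map (twist G) hSeries = 1 := by
    rw [← map_mul, E_mul_hSeries, map_one]
  have h2 : PowerSeries.map Polynomial.C E * PowerSeries.map Polynomial.C hSeries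
      = (1 : PowerSeries B[X]) := by
    rw [← map_mul, E_mul_hSeries, map_one]
  rw [map_twist_E hG] at h1
  refine (left_inv_eq_right_inv ?_ h1).symm
  calc _ = (PowerSeries.map Polynomial.C E * PowerSeries.map Polynomial.C hSeries) * (G * G') := by
        ring
    _ = 1 := by rw [h2, hGG', one_mul]

/-- The series `1 / (1 - t w)`. -/
def geomSeries : PowerSeries B[X] := PowerSeries.mk fun n => Polynomial.X ^ n

/-- The series `1 - t w`. -/
def linSeries : PowerSeries B[X] := 1 - PowerSeries.C Polynomial.X * PowerSeries.X

theorem geomSeries_mul_linSeries : geomSeries * linSeries = 1 := by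
  ext1 n
  rw [linSeries, mul_sub, mul_one, ← mul_assoc, map_sub]
  rcases n with _ | n
  · simp [geomSeries]
  · rw [PowerSeries.coeff_succ_mul_X, PowerSeries.coeff_mul_C, geomSeries, PowerSeries.coeff_mk,
      PowerSeries.coeff_mk, ← pow_succ, sub_self, PowerSeries.coeff_one,
      if_neg (Nat.succ_ne_zero n)]

/-- The ring homomorphism `σ̄₋(z) : B → B[z⁻¹]`. -/
def barHom : B →+* B[X] := twist geomSeries

/-- The ring homomorphism `σ₋(z) : B → B[z⁻¹]`. -/
def minusHom : B →+* B[X] := twist linSeries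

theorem barHom_h (n : ℤ) :
    barHom (h n) = Polynomial.C (h n) - Polynomial.C (h (n - 1)) * Polynomial.X := by
  rcases lt_or_ge n 0 with hn | hn
  · rw [h_of_neg hn, h_of_neg (by omega)]
    simp
  · obtain ⟨n, rfl⟩ := Int.eq_ofNat_of_zero_le hn
    rw [← coeff_hSeries, ← PowerSeries.coeff_map, barHom,
      map_twist_hSeries (by simp [geomSeries]) geomSeries_mul_linSeries, linSeries, mul_sub,
      mul_one, ← mul_assoc, map_sub, PowerSeries.coeff_map]
    congr 1
    rcases n with _ | n
    · rw [h_of_neg (by simp)]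
      simp
    · rw [PowerSeries.coeff_succ_mul_X, PowerSeries.coeff_mul_C, PowerSeries.coeff_map,
        coeff_hSeries]
      simp

theorem coeff_minusHom_h (n : ℤ) (j : ℕ) : (minusHom (h n)).coeff j = h (n - j) := by
  rcases lt_or_ge n 0 with hn | hn
  · rw [h_of_neg hn, h_of_neg (by omega)]
    simp
  · obtain ⟨n, rfl⟩ := Int.eq_ofNat_of_zero_le hn
    rw [← coeff_hSeries, ← PowerSeries.coeff_map, minusHom,
      map_twist_hSeries (by simp [linSeries]) ((mul_comm _ _).trans geomSeries_mul_linSeries),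
      PowerSeries.coeff_mul, Polynomial.finsetSum_coeff]
    simp only [PowerSeries.coeff_map, geomSeries, PowerSeries.coeff_mk, Polynomial.coeff_C_mul,
      Polynomial.coeff_X_pow, coeff_hSeries]
    rcases le_or_gt j n with hj | hj
    · rw [Finset.sum_eq_single (n - j, j)]
      · rw [if_pos rfl, mul_one, Nat.cast_sub hj]
      · rintro ⟨a, c⟩ hp hne
        have hp := Finset.HasAntidiagonal.mem_antidiagonal.1 hp
        rw [if_neg, mul_zero]
        rintro rfl
        apply hne
        simp only at hp
        rw [← hp, Nat.add_sub_cancel]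
      · intro hp
        exact absurd (Finset.HasAntidiagonal.mem_antidiagonal.2 (Nat.sub_add_cancel hj)) hp
    · rw [h_of_neg (by omega)]
      refine Finset.sum_eq_zero fun p hp => ?_
      have hp := Finset.HasAntidiagonal.mem_antidiagonal.1 hp
      rw [if_neg (by omega), mul_zero]

/-- This puts `barHom` in the form `c_j • h_{n-j}`, with the same `c_j` by which `σ̄₋` acts on the
`b_i`; the intertwining argument needs exactly this match. -/
theorem coeff_barHom_h (n : ℤ) (j : ℕ) :
    (barHom (h n)).coeff j = (if j = 0 then 1 else if j = 1 then -1 else 0 : ℤ) • h (n - j) := by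
  rw [barHom_h]
  rcases j with _ | _ | j
  · simp
  · simp
  · simp

theorem coeff_zero_eq_self_of_h {S : B →+* B[X]} (hS : ∀ n, (S (h n)).coeff 0 = h n) (f : B) :
    (S f).coeff 0 = f := by
  induction f using boson_induction with
  | hh n => exact hS n
  | hint c => simp
  | hadd f g hf hg => rw [map_add, Polynomial.coeff_add, hf, hg]
  | hmul f g hf hg => rw [map_mul, Polynomial.mul_coeff_zero, hf, hg]

/-! ### Determinants and vertex operators -/

/-- The determinant `det(h_{ν_j + i})`. -/
def hDet {r : ℕ} (nu : Fin r → ℤ) : B :=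
  Matrix.det (Matrix.of fun i j : Fin r => h (nu j + (i : ℕ)))

theorem schurDet_h {r : ℕ} (lam : Fin r → ℕ) :
    schurDet h lam = hDet fun j => (lam j : ℤ) - (j : ℕ) := rfl

/-- The `B`-linear map `B[t] → B` with `t ^ k ↦ h_{c + k}`. -/
def contract (c : ℤ) : B[X] →ₗ[B] B :=
  Polynomial.lsum fun k => LinearMap.mulRight B (h (c + k))

theorem contract_eq_sum (c : ℤ) (q : B[X]) :
    contract c q = q.sum fun k a => a * h (c + k) := rfl

theorem contract_C_mul_X_pow (c : ℤ) (a : B) (k : ℕ) :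
    contract c (Polynomial.C a * Polynomial.X ^ k) = a * h (c + k) := by
  rw [contract_eq_sum, Polynomial.C_mul_X_pow_eq_monomial]
  exact Polynomial.sum_monomial_index _ _ (zero_mul _)

/-- The operator on `B` which corresponds to the exterior multiplication by `b_{m+c}` from
charge `m - 1` to charge `m`. -/
def vertex (c : ℤ) : B →+ B := (contract c).toAddMonoidHom.comp barHom.toAddMonoidHom

theorem vertex_apply (c : ℤ) (p : B) : vertex c p = contract c (barHom p) := rfl

theorem contract_mul_X (c : ℤ) (q : B[X]) : contract c (q * Polynomial.X) = contract (c + 1) q := by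
  induction q using Polynomial.induction_on' with
  | add p q hp hq => rw [add_mul, map_add, hp, hq, map_add]
  | monomial k a =>
    rw [← Polynomial.C_mul_X_pow_eq_monomial, mul_assoc, ← pow_succ, contract_C_mul_X_pow,
      contract_C_mul_X_pow]
    congr 2
    push_cast
    ring

/-- `barHom` turns the factor `h_n` into `h_n - h_{n-1} t`, and `contract` turns the factor `t` into
a shift of `c`. This is the bosonic form of the commutation relation `bosonAction_h_mul_wedgeOp`. -/
theorem h_mul_vertex (n c : ℤ) (p : B) :
    h n * vertex c p = vertex c (h n * p) + h (n - 1) * vertex (c + 1) p := by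
  rw [vertex_apply, vertex_apply, vertex_apply, map_mul, barHom_h, sub_mul, map_sub,
    mul_right_comm, contract_mul_X, ← Polynomial.smul_eq_C_mul, ← Polynomial.smul_eq_C_mul,
    map_smul, map_smul, smul_eq_mul, smul_eq_mul, sub_add_cancel]

theorem vertex_one (c : ℤ) : vertex c 1 = h c := by
  have h1 := contract_C_mul_X_pow c 1 0
  rw [vertex_apply, map_one]
  simpa using h1

/-- Subtracting `t` times the preceding row from each row reduces the column of powers to `(1, 0, …,
0)`; then expand along it. -/
theorem det_cons_pow {R : Type*} [CommRing R] (t : R) {r : ℕ} (f : Fin r → ℕ → R) :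
    Matrix.det (Matrix.of fun i j : Fin (r + 1) =>
        (Fin.cons (t ^ (i : ℕ)) (fun j => f j i) : Fin (r + 1) → R) j)
      = Matrix.det (Matrix.of fun i j : Fin r => f j (i + 1) - f j i * t) := by
  rw [Matrix.det_eq_of_forall_row_eq_smul_add_pred
    (B := Matrix.of fun i j : Fin (r + 1) =>
      (Fin.cons (if i = 0 then 1 else 0)
        (fun j => f j i - if i = 0 then 0 else f j (i - 1) * t) : Fin (r + 1) → R) j)
    (fun _ => t), Matrix.det_succ_column_zero, Fin.sum_univ_succ, Finset.sum_eq_zero]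
  · simp only [Fin.val_zero, pow_zero, Matrix.of_apply, Fin.cons_zero, if_true, one_mul, add_zero]
    congr 1
  · intro i _
    simp
  · intro j
    refine Fin.cases ?_ (fun j => ?_) j <;> simp
  · intro i j
    refine Fin.cases ?_ (fun j => ?_) j
    · simp [pow_succ, mul_comm]
    · simp [mul_comm t]

/-- Only the first column involves `t`, so after expansion along it the `B`-linear map replaces each
`t ^ i` by `h_{c+i}` and leaves the minors alone. -/
theorem contract_det_cons (c : ℤ) {r : ℕ} (f : Fin r → ℕ → B) :
    contract c (Matrix.det (Matrix.of fun i j : Fin (r + 1) =>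
        (Fin.cons (Polynomial.X ^ (i : ℕ)) (fun j => Polynomial.C (f j i)) :
          Fin (r + 1) → B[X]) j))
      = Matrix.det (Matrix.of fun i j : Fin (r + 1) =>
        (Fin.cons (h (c + (i : ℕ))) (fun j => f j i) : Fin (r + 1) → B) j) := by
  rw [Matrix.det_succ_column_zero, Matrix.det_succ_column_zero, map_sum]
  refine Finset.sum_congr rfl fun i _ => ?_
  set d := Matrix.det (Matrix.of fun k j : Fin r => f j (i.succAbove k))
  have h1 : Matrix.det ((Matrix.of fun i j : Fin (r + 1) =>
      (Fin.cons (Polynomial.X ^ (i : ℕ)) (fun j => Polynomial.C (f j i)) :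
        Fin (r + 1) → B[X]) j).submatrix i.succAbove Fin.succ) = Polynomial.C d := by
    rw [RingHom.map_det]
    congr 1
  have h2 : Matrix.det ((Matrix.of fun i j : Fin (r + 1) =>
      (Fin.cons (h (c + (i : ℕ))) (fun j => f j i) :
        Fin (r + 1) → B) j).submatrix i.succAbove Fin.succ) = d := by
    congr 1
  have h3 := contract_C_mul_X_pow c ((-1) ^ (i : ℕ) * d) i
  rw [h1, h2]
  simp only [Matrix.of_apply, Fin.cons_zero]
  rw [mul_right_comm _ (h _), ← h3, map_mul Polynomial.C, map_pow, map_neg, map_one,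
    mul_right_comm]

/-- `barHom` replaces the entries by `h_{ν+i+1} - h_{ν+i} t`, which is the reduced form in
`det_cons_pow`; undoing the row operations restores a column of powers of `t`, and `contract` fills
it with the `h_{c+i}`. -/
theorem vertex_hDet {r : ℕ} (c : ℤ) (nu : Fin r → ℤ) :
    vertex c (hDet fun j => nu j + 1) = hDet (Fin.cons c nu : Fin (r + 1) → ℤ) := by
  have h1 : barHom (hDet fun j => nu j + 1) = Matrix.det (Matrix.of fun i j : Fin r =>
      Polynomial.C (h (nu j + (i + 1 : ℕ))) - Polynomial.C (h (nu j + (i : ℕ))) * Polynomial.X) := by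
    rw [hDet, RingHom.map_det]
    congr 1
    ext1 i j
    simp only [RingHom.mapMatrix_apply, Matrix.map_apply, Matrix.of_apply, barHom_h]
    rw [show nu j + 1 + ((i : ℕ) : ℤ) = nu j + ((i + 1 : ℕ) : ℤ) by push_cast; ring,
      show nu j + ((i + 1 : ℕ) : ℤ) - 1 = nu j + (i : ℕ) by push_cast; ring]
  rw [vertex_apply, h1, ← det_cons_pow Polynomial.X fun j i => Polynomial.C (h (nu j + (i : ℕ))),
    contract_det_cons c fun j i => h (nu j + (i : ℕ)), hDet]
  congr 1
  ext1 i j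
  refine Fin.cases ?_ (fun j => ?_) j <;> simp

/-! ### The Schur determinants span `B` -/

/-- A Pieri-type argument: the span contains `1` and is stable under vertex operators. The relation
`h_mul_vertex` makes it stable under each `h_n`, by induction on the size of the determinant and
then on `n`, so it is all of `B`. -/
theorem mem_span_hDet (p : B) : p ∈ Submodule.span ℤ {q | ∃ (r : ℕ) (nu : Fin r → ℤ), q = hDet nu} := by
  set N := Submodule.span ℤ {q | ∃ (r : ℕ) (nu : Fin r → ℤ), q = hDet nu} with hN
  have hone : (1 : B) ∈ N := Submodule.subset_span ⟨0, Fin.elim0, by simp [hDet]⟩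
  have hvertex : ∀ (q : B), q ∈ N → ∀ c, vertex c q ∈ N := by
    intro q hq c
    induction hq using Submodule.span_induction with
    | mem q hq =>
      obtain ⟨r, nu, rfl⟩ := hq
      refine Submodule.subset_span ⟨r + 1, Fin.cons c fun j => nu j - 1, ?_⟩
      rw [← vertex_hDet]
      simp
    | zero => rw [map_zero]; exact zero_mem _
    | add x y _ _ hx hy => rw [map_add]; exact add_mem hx hy
    | smul a x _ hx => rw [map_zsmul]; exact N.smul_mem a hx
  have key : ∀ (r : ℕ) (nu : Fin r → ℤ) (n : ℤ), h n * hDet nu ∈ N := by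
    intro r
    induction r with
    | zero =>
      intro nu n
      rw [show hDet nu = 1 by simp [hDet], mul_one, ← vertex_one]
      exact hvertex _ hone _
    | succ r ih =>
      have hnat : ∀ (n : ℕ) (nu : Fin (r + 1) → ℤ), h n * hDet nu ∈ N := by
        intro n
        induction n with
        | zero =>
          intro nu
          rw [Nat.cast_zero, h_zero, one_mul]
          exact Submodule.subset_span ⟨_, nu, rfl⟩
        | succ n ihn =>
          intro nu
          have h1 : hDet nu = vertex (nu 0) (hDet fun j => nu j.succ + 1) := by
            rw [vertex_hDet]
            congr 1
            exact (Fin.cons_self_tail nu).symm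
          -- The first summand involves a determinant of smaller size, the second a smaller index of
          -- `h`.
          rw [h1, h_mul_vertex]
          refine add_mem (hvertex _ (ih _ _) _) ?_
          rw [vertex_hDet]
          simpa using ihn _
      intro nu n
      rcases lt_or_ge n 0 with hn | hn
      · rw [h_of_neg hn, zero_mul]
        exact zero_mem _
      · obtain ⟨n, rfl⟩ := Int.eq_ofNat_of_zero_le hn
        exact hnat n nu
  have hmul : ∀ q ∈ N, ∀ n, h n * q ∈ N := by
    intro q hq n
    induction hq using Submodule.span_induction with
    | mem q hq =>
      obtain ⟨r, nu, rfl⟩ := hq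
      exact key r nu n
    | zero => rw [mul_zero]; exact zero_mem _
    | add x y _ _ hx hy => rw [mul_add]; exact add_mem hx hy
    | smul a x _ hx => rw [mul_smul_comm]; exact N.smul_mem a hx
  have hall : ∀ p : B, ∀ q ∈ N, p * q ∈ N := by
    intro p
    induction p using boson_induction with
    | hh n => exact fun q hq => hmul q hq n
    | hint c =>
      intro q hq
      rw [← zsmul_eq_mul]
      exact N.smul_mem c hq
    | hadd f g hf hg =>
      intro q hq
      rw [add_mul]
      exact add_mem (hf q hq) (hg q hq)
    | hmul f g hf hg =>
      intro q hq
      rw [mul_assoc]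
      exact hf _ (hg q hq)
  simpa using hall p 1 hone

theorem hDet_eq_zero_of_le {r : ℕ} (nu : Fin r → ℤ) (j : Fin r) (hj : nu j ≤ -r) : hDet nu = 0 := by
  refine Matrix.det_eq_zero_of_column_eq_zero j fun i => ?_
  have := i.2
  exact h_of_neg (by omega)

theorem hDet_comp_perm {r : ℕ} (nu : Fin r → ℤ) (s : Equiv.Perm (Fin r)) :
    hDet (nu ∘ s) = Equiv.Perm.sign s * hDet nu :=
  Matrix.det_permute' s (Matrix.of fun i j : Fin r => h (nu j + (i : ℕ)))

/-- The determinant is alternating in `ν`, so it vanishes or, up to sign, `ν` may be taken strictly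
decreasing. Then either the last column is zero or `ν_j + j` (indices from `0`) is a partition. -/
theorem span_schurDet :
    Submodule.span ℤ {q | ∃ (r : ℕ) (lam : Fin r → ℕ), Antitone lam ∧ q = schurDet h lam} = ⊤ := by
  set N := Submodule.span ℤ {q | ∃ (r : ℕ) (lam : Fin r → ℕ), Antitone lam ∧ q = schurDet h lam}
  have hanti : ∀ (r : ℕ) (nu : Fin r → ℤ), StrictAnti nu → hDet nu ∈ N := by
    intro r nu hnu
    rcases r with _ | r
    · exact Submodule.subset_span ⟨0, fun _ => 0, fun _ _ _ => le_rfl, by simp [hDet, schurDet]⟩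
    rcases le_or_gt (nu (Fin.last r)) (-(r + 1 : ℕ)) with hl | hl
    · rw [hDet_eq_zero_of_le nu _ hl]
      exact zero_mem _
    have hf : Antitone fun j : Fin (r + 1) => nu j + (j : ℕ) := by
      rw [Fin.antitone_iff_succ_le]
      intro i
      have := hnu (Fin.castSucc_lt_succ (i := i))
      simp only [Fin.val_succ, Fin.val_castSucc]
      push_cast
      omega
    -- By monotonicity it suffices to look at the last index, where the bound `hl` on `ν` applies.
    have hpos : ∀ j, 0 ≤ nu j + (j : ℕ) := by
      intro j
      have := hf (Fin.le_last j)
      simp only [Fin.val_last] at this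
      omega
    refine Submodule.subset_span ⟨r + 1, fun j => (nu j + (j : ℕ)).toNat,
      fun i j hij => Int.toNat_le_toNat (hf hij), ?_⟩
    rw [schurDet_h]
    congr 1
    funext j
    rw [Int.toNat_of_nonneg (hpos j), add_sub_cancel_right]
  rw [eq_top_iff]
  rintro p -
  refine Submodule.span_le.2 ?_ (mem_span_hDet p)
  rintro _ ⟨r, nu, rfl⟩
  by_cases hinj : Function.Injective nu
  -- Negation makes the increasing sort produce a decreasing order.
  · set s := Tuple.sort fun j => -nu j
    have hs : StrictAnti (nu ∘ s) := by
      have hm : Monotone fun j => -nu (s j) := Tuple.monotone_sort fun j => -nu j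
      have ha : Antitone (nu ∘ s) := fun i j hij => neg_le_neg_iff.1 (hm hij)
      exact ha.strictAnti_of_injective (hinj.comp s.injective)
    have h1 := hanti r _ hs
    rw [hDet_comp_perm] at h1
    have h2 : hDet nu = (Equiv.Perm.sign s : ℤ) • ((Equiv.Perm.sign s : ℤ) * hDet nu : B) := by
      rw [zsmul_eq_mul, ← mul_assoc, ← Int.cast_mul, ← Units.val_mul, Int.units_mul_self]
      simp
    rw [SetLike.mem_coe, h2]
    exact N.smul_mem _ (by simpa using h1)
  · obtain ⟨i, j, hij, hne⟩ := Function.not_injective_iff.1 hinj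
    have : hDet nu = 0 := Matrix.det_zero_of_column_eq hne fun k => by simp [hij]
    rw [this]
    exact zero_mem _

/-! ### The boson-fermion correspondence -/

/-- The operator `x ↦ b_i ∧ x` on `F`. -/
def wedgeOp (i : ℤ) : Module.End ℤ Fock :=
  AddMonoidHom.toIntLinearMap (DistribSMul.toAddMonoidHom Fock (eb i))

theorem wedgeOp_apply (i : ℤ) (x : Fock) : wedgeOp i x = eb i • x := rfl

/-- For `n < 0` both sides vanish, since `b_{m+n}` already occurs in `[b]_{m-1}`; hence all integers
`n` are allowed. -/
theorem bosonAction_h_vac (n m : ℤ) : bosonAction (h n) (vac m) = eb (m + n) • vac (m - 1) := by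
  rcases lt_or_ge n 0 with hn | hn
  · rw [h_of_neg hn, map_zero, eb_smul_vac_of_le (by omega), LinearMap.zero_apply]
  · obtain ⟨n, rfl⟩ := Int.eq_ofNat_of_zero_le hn
    rw [bosonAction_h, sigmaOp_vac]

/-- This is a coefficient of `σ₊(z)b_i = b_i + z σ₊(z)b_{i+1}`, combined with the multiplicativity
of `σ₊(z)`. -/
theorem bosonAction_h_mul_wedgeOp (n i : ℤ) :
    bosonAction (h n) * wedgeOp i
      = wedgeOp i * bosonAction (h n) + bosonAction (h (n - 1)) * wedgeOp (i + 1) := by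
  rcases lt_or_ge n 0 with hn | hn
  · rw [h_of_neg hn, h_of_neg (by omega), map_zero, zero_mul, mul_zero, zero_mul, add_zero]
  · obtain ⟨n, rfl⟩ := Int.eq_ofNat_of_zero_le hn
    rcases n with _ | n
    · rw [h_of_neg (n := ((0 : ℕ) : ℤ) - 1) (by simp), Nat.cast_zero, h_zero, map_one, map_zero,
        one_mul, mul_one, zero_mul, add_zero]
    · rw [show ((n + 1 : ℕ) : ℤ) - 1 = n by push_cast; ring, bosonAction_h, bosonAction_h]
      refine LinearMap.ext fun x => ?_
      simp only [LinearMap.add_apply, Module.End.mul_apply, wedgeOp_apply]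
      rw [sigmaOp_smul, sigmaOp_smul, Finset.Nat.antidiagonal_succ, Finset.sum_cons, Finset.sum_map]
      simp only [coeff_sigmaPlus]
      congr 1
      · simp
      · refine Finset.sum_congr rfl fun p _ => ?_
        congr 2
        simp
        ring

/-- The ring homomorphism which lets operators on `F` act on families indexed by `ℤ`. -/
def familyHom : Module.End ℤ Fock →+* Module.End ℤ (ℤ → Fock) where
  toFun f := f.compLeft ℤ
  map_one' := rfl
  map_mul' _ _ := rfl
  map_zero' := rfl
  map_add' _ _ := rfl

/-- The action of `B[t]` on families indexed by `ℤ`, with `t` acting as the shift. -/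
def familyAction : B[X] →+* Module.End ℤ (ℤ → Fock) :=
  Polynomial.eval₂RingHom' (familyHom.comp bosonAction)
    (LinearMap.funLeft ℤ Fock fun j : ℤ => j + 1) fun _ => rfl

theorem familyAction_C (a : B) (f : ℤ → Fock) (j : ℤ) :
    familyAction (Polynomial.C a) f j = bosonAction a (f j) := by
  have h1 : familyAction (Polynomial.C a) = familyHom (bosonAction a) := Polynomial.eval₂_C _ _
  rw [h1]
  rfl

theorem familyAction_X (f : ℤ → Fock) (j : ℤ) :
    familyAction Polynomial.X f j = f (j + 1) := by
  have h1 : familyAction Polynomial.X = LinearMap.funLeft ℤ Fock fun j : ℤ => j + 1 :=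
    Polynomial.eval₂_X _ _
  rw [h1]
  rfl

theorem familyAction_X_pow (k : ℕ) (f : ℤ → Fock) (j : ℤ) :
    familyAction (Polynomial.X ^ k) f j = f (j + k) := by
  induction k generalizing j with
  | zero => simp
  | succ k ih =>
    rw [pow_succ', map_mul, Module.End.mul_apply, familyAction_X, ih]
    congr 1
    push_cast
    ring

/-- Solved for `b_j h_n`, the commutation relation reads `h_n b_j - h_{n-1} b_{j+1}`, which is
`barHom h_n` with `t` as the shift of `j`. Both sides are multiplicative in `p`. -/
theorem wedgeOp_mul_bosonAction (p : B) (x : Fock) :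
    (fun j => wedgeOp j (bosonAction p x)) = familyAction (barHom p) fun j => wedgeOp j x := by
  induction p using boson_induction generalizing x with
  | hh n =>
    funext j
    have h1 := LinearMap.congr_fun (bosonAction_h_mul_wedgeOp n j) x
    simp only [LinearMap.add_apply, Module.End.mul_apply] at h1
    rw [barHom_h, map_sub, map_mul, LinearMap.sub_apply, Module.End.mul_apply, Pi.sub_apply,
      familyAction_C, familyAction_C, familyAction_X, h1, add_sub_cancel_right]
  | hint c =>
    rw [map_intCast, map_intCast, map_intCast]
    funext j
    simp
  | hadd f g hf hg =>
    rw [map_add, map_add, map_add, LinearMap.add_apply, LinearMap.add_apply, ← hf, ← hg]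
    funext j
    simp
  | hmul f g hf hg =>
    rw [map_mul, map_mul, map_mul, Module.End.mul_apply, Module.End.mul_apply, ← hg, ← hf]

/-- Since `b_{j+k} ∧ [b]_{m-1} = h_{j-m+k}[b]_m`, the monomial `t ^ k` acts as `h_{j-m+k}`, which is
what `contract` records. -/
theorem familyAction_wedge_vac (q : B[X]) (j m : ℤ) :
    familyAction q (fun j => wedgeOp j (vac (m - 1))) j
      = bosonAction (contract (j - m) q) (vac m) := by
  induction q using Polynomial.induction_on' with
  | add p q hp hq =>
    rw [map_add, map_add, map_add, LinearMap.add_apply, LinearMap.add_apply, Pi.add_apply, hp, hq]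
  | monomial k a =>
    rw [← Polynomial.C_mul_X_pow_eq_monomial, contract_C_mul_X_pow, map_mul, map_mul,
      Module.End.mul_apply, Module.End.mul_apply, familyAction_C, familyAction_X_pow,
      bosonAction_h_vac, wedgeOp_apply]
    congr 3
    ring_nf

theorem eb_smul_bosonAction_vac (j m : ℤ) (p : B) :
    eb j • bosonAction p (vac (m - 1)) = bosonAction (vertex (j - m) p) (vac m) := by
  rw [vertex_apply, ← familyAction_wedge_vac, ← wedgeOp_mul_bosonAction]
  rfl

/-- The Giambelli formula: each vertex operator adds one column on the bosonic side and one wedge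
factor on the fermionic side, while the charge rises by one. -/
theorem bosonAction_hDet_vac {r : ℕ} (nu : Fin r → ℤ) (m : ℤ) :
    bosonAction (hDet nu) (vac m)
      = ExteriorAlgebra.ιMulti ℤ r (fun j => b (m + nu j)) • vac (m - r) := by
  induction r generalizing m with
  | zero => simp [hDet]
  | succ r ih =>
    obtain ⟨c, nu, rfl⟩ : ∃ c nu', nu = Fin.cons c nu' := ⟨_, _, (Fin.cons_self_tail nu).symm⟩
    rw [show c = m + c - m by ring, ← vertex_hDet, ← eb_smul_bosonAction_vac, ih,
      ExteriorAlgebra.ιMulti_succ_apply, ← smul_smul, show m - 1 - (r : ℤ) = m - (r + 1 : ℕ) by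
        push_cast; ring]
    congr 1
    · simp [eb]
    · congr 2
      funext j
      simp only [Matrix.vecTail, Function.comp_apply, Fin.cons_succ]
      congr 1
      ring

theorem bosonAction_schurDet_vac {r : ℕ} (lam : Fin r → ℕ) :
    bosonAction (schurDet h lam) (vac 0) = fockBasis 0 lam := by
  rw [schurDet_h, bosonAction_hDet_vac, fockBasis]
  congr 2
  funext j
  congr 1
  ring

/-! ### Faithfulness of the action on the vacuum -/

/-- The linear map `M → B ^ r` with `b_n ↦ (h_n, …, h_{n+r-1})`. -/
def rowMap (r : ℕ) : FreeM →ₗ[ℤ] (Fin r → B) :=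
  Finsupp.linearCombination ℤ fun n i => h (n + (i : ℕ))

theorem rowMap_b (r : ℕ) (n : ℤ) (i : Fin r) : rowMap r (b n) i = h (n + (i : ℕ)) := by
  simp [rowMap, b]

theorem rowMap_castSucc (r : ℕ) (u : FreeM) (i : Fin r) :
    rowMap (r + 1) u i.castSucc = rowMap r u i := by
  simp [rowMap, Finsupp.linearCombination_apply, Finsupp.sum]

/-- The alternating map `(b_{n_1}, …, b_{n_r}) ↦ det(h_{n_j + i})`. -/
def detAlternating (r : ℕ) : FreeM [⋀^Fin r]→ₗ[ℤ] B :=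
  AlternatingMap.compLinearMap
    { (Matrix.detRowAlternating (R := B) (n := Fin r)).toMultilinearMap.restrictScalars ℤ with
      map_eq_zero_of_eq' := fun v _ _ hv hij => Matrix.detRowAlternating.map_eq_zero_of_eq v hv hij }
    (rowMap r)

theorem detAlternating_apply {r : ℕ} (v : Fin r → FreeM) :
    detAlternating r v = Matrix.det (Matrix.of fun j => rowMap r (v j)) := rfl

theorem detAlternating_b {r : ℕ} (nu : Fin r → ℤ) :
    detAlternating r (fun j => b (nu j)) = hDet nu := by
  rw [detAlternating_apply, hDet, ← Matrix.det_transpose]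
  congr 1
  ext1 i j
  simp [rowMap_b]

/-- The row of `b_{-r}` is `(h_{-r}, …, h_0) = (0, …, 0, 1)`. This matches the relation `b_m ∧
[b]_{m-1} = [b]_m` at `m = -r`. -/
theorem detAlternating_snoc {r : ℕ} (v : Fin r → FreeM) :
    detAlternating (r + 1) (Fin.snoc v (b (-r))) = detAlternating r v := by
  rw [detAlternating_apply, detAlternating_apply, Matrix.det_succ_row _ (Fin.last r),
    Finset.sum_eq_single (Fin.last r)]
  · rw [Fin.succAbove_last]
    have h1 : (Matrix.of fun j => rowMap (r + 1) ((Fin.snoc v (b (-r)) : Fin (r + 1) → FreeM) j))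
        (Fin.last r) (Fin.last r) = 1 := by
      simp [rowMap_b, h_zero]
    rw [h1, ← two_mul, pow_mul, mul_one]
    simp only [even_two, Even.neg_pow, one_pow, one_mul]
    congr 1
    ext1 i j
    simp [rowMap_castSucc]
  · intro j _ hj
    have hj := Fin.val_lt_last hj
    have h1 : (Matrix.of fun j => rowMap (r + 1) ((Fin.snoc v (b (-r)) : Fin (r + 1) → FreeM) j))
        (Fin.last r) j = 0 := by
      simp only [Matrix.of_apply, Fin.snoc_last, rowMap_b]
      exact h_of_neg (by omega)
    rw [h1, mul_zero, zero_mul]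
  · simp

/-- The row of `b_{-(r+1)}` has only `h` of negative index. This matches the relation `b_m ∧ [b]_m =
0` at `m = -(r+1)`. -/
theorem detAlternating_snoc_eq_zero {r : ℕ} (v : Fin r → FreeM) :
    detAlternating (r + 1) (Fin.snoc v (b (-(r + 1 : ℕ)))) = 0 := by
  rw [detAlternating_apply]
  refine Matrix.det_eq_zero_of_row_eq_zero (Fin.last r) fun j => ?_
  have := j.2
  simp only [Matrix.of_apply, Fin.snoc_last, rowMap_b]
  exact h_of_neg (by omega)

theorem ιMulti_mul_eb {r : ℕ} (v : Fin r → FreeM) (m : ℤ) :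
    ExteriorAlgebra.ιMulti ℤ r v * eb m = ExteriorAlgebra.ιMulti ℤ (r + 1) (Fin.snoc v (b m)) := by
  rw [ExteriorAlgebra.ιMulti_apply, ExteriorAlgebra.ιMulti_apply, List.ofFn_succ', List.concat_eq_append,
    List.prod_append]
  simp [eb]

/-- The linear map `⋀ M → B` which reads off the boson of `u ∧ [b]_m` in charge `0`. -/
def readout (m : ℤ) : ExtM →ₗ[ℤ] B :=
  ExteriorAlgebra.liftAlternating fun r => if m = -r then detAlternating r else 0

theorem readout_ιMulti (m : ℤ) {r : ℕ} (v : Fin r → FreeM) :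
    readout m (ExteriorAlgebra.ιMulti ℤ r v) = if m = -r then detAlternating r v else 0 := by
  rw [readout, ExteriorAlgebra.liftAlternating_apply_ιMulti]
  split_ifs <;> rfl

theorem readout_mul_eb_pred (m : ℤ) (u : ExtM) : readout (m - 1) (u * eb m) = readout m u := by
  have : (readout (m - 1)).comp (LinearMap.mulRight ℤ (eb m)) = readout m := by
    refine ExteriorAlgebra.lhom_ext fun r => ?_
    ext v
    simp only [LinearMap.compAlternatingMap_apply, LinearMap.comp_apply, LinearMap.mulRight_apply]
    rw [ιMulti_mul_eb, readout_ιMulti, readout_ιMulti]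
    by_cases hm : m = -r
    · rw [if_pos hm, if_pos (by omega), hm, detAlternating_snoc]
    · rw [if_neg hm, if_neg (by omega)]
  exact LinearMap.congr_fun this u

theorem readout_mul_eb (m : ℤ) (u : ExtM) : readout m (u * eb m) = 0 := by
  have : (readout m).comp (LinearMap.mulRight ℤ (eb m)) = 0 := by
    refine ExteriorAlgebra.lhom_ext fun r => ?_
    ext v
    simp only [LinearMap.compAlternatingMap_apply, LinearMap.comp_apply, LinearMap.mulRight_apply]
    rw [ιMulti_mul_eb, readout_ιMulti]
    split_ifs with hm
    · rw [hm, detAlternating_snoc_eq_zero]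
      rfl
    · rfl
  exact LinearMap.congr_fun this u

/-- The linear map `⋀ M ⊗ [M] → B` assembled from the maps `readout m`. -/
def readoutAux : (ExtM ⊗[ℤ] VacM) →ₗ[ℤ] B :=
  TensorProduct.lift (Finsupp.lift (ExtM →ₗ[ℤ] B) ℤ ℤ readout).flip

theorem readoutAux_tmul (u : ExtM) (m : ℤ) :
    readoutAux (u ⊗ₜ[ℤ] (Finsupp.single m 1 : VacM)) = readout m u := by
  have h1 : readoutAux (u ⊗ₜ[ℤ] (Finsupp.single m 1 : VacM))
      = (Finsupp.lift (ExtM →ₗ[ℤ] B) ℤ ℤ readout) (Finsupp.single m 1) u :=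
    TensorProduct.lift.tmul _ _
  have h2 : (Finsupp.lift (ExtM →ₗ[ℤ] B) ℤ ℤ readout) (Finsupp.single m 1) = readout m := by simp
  rw [h1, h2]

theorem readoutAux_eq_zero (x : ExtM ⊗[ℤ] VacM) (hx : x ∈ fockRel) : readoutAux x = 0 := by
  -- `readoutAux` is only `ℤ`-linear, so the induction over the `⋀ M`-span must carry all multiples.
  suffices H : ∀ u : ExtM, readoutAux (u • x) = 0 by simpa using H 1
  induction hx using Submodule.span_induction with
  | mem x hx =>
    intro u
    rcases hx with ⟨m, rfl⟩ | ⟨m, rfl⟩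
    · simp only [smul_sub, map_sub, TensorProduct.smul_tmul', readoutAux_tmul, smul_eq_mul,
        readout_mul_eb_pred, mul_one, sub_self]
    · simp only [TensorProduct.smul_tmul', readoutAux_tmul, smul_eq_mul, readout_mul_eb]
  | zero =>
    intro u
    rw [smul_zero, map_zero]
  | add x y _ _ hx hy =>
    intro u
    rw [smul_add, map_add, hx, hy, add_zero]
  | smul w x _ hx =>
    intro u
    rw [smul_smul]
    exact hx _

/-- The additive map `F → B` with `Δ_λ(H) [b]_0 ↦ Δ_λ(H)`. -/
def readoutFock : Fock →+ B :=
  QuotientAddGroup.lift fockRel.toAddSubgroup readoutAux.toAddMonoidHom readoutAux_eq_zero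

theorem readoutFock_smul_vac (u : ExtM) (m : ℤ) : readoutFock (u • vac m) = readout m u := by
  rw [← toFock_tmul_single, ← readoutAux_tmul]
  rfl

theorem readoutFock_bosonAction_vac (p : B) : readoutFock (bosonAction p (vac 0)) = p := by
  induction mem_span_hDet p using Submodule.span_induction with
  | mem x hx =>
    obtain ⟨r, nu, rfl⟩ := hx
    rw [bosonAction_hDet_vac, readoutFock_smul_vac, readout_ιMulti, if_pos (zero_sub _)]
    simp only [zero_add]
    exact detAlternating_b nu
  | zero => simp
  | add x y _ _ hx hy => rw [map_add, LinearMap.add_apply, map_add, hx, hy]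
  | smul a x _ hx => rw [map_zsmul, LinearMap.smul_apply, map_zsmul, hx]

theorem mulVac_injective : Function.Injective mulVac := by
  intro p q hpq
  ext1 n
  rw [← readoutFock_bosonAction_vac (p.coeff n), ← readoutFock_bosonAction_vac (q.coeff n)]
  exact congrArg readoutFock (congrFun hpq n)

/-! ### Series of operators on `F` -/

/-- The value at `x ∈ F` of a formal power series of operators on `F`. -/
def evalSeries (A : PowerSeries (Module.End ℤ Fock)) (x : Fock) : ℕ → Fock :=
  fun n => PowerSeries.coeff n A x

theorem evalSeries_add (A A' : PowerSeries (Module.End ℤ Fock)) (x : Fock) :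
    evalSeries (A + A') x = evalSeries A x + evalSeries A' x := by
  funext n
  simp [evalSeries]

theorem evalSeries_mul_C (A : PowerSeries (Module.End ℤ Fock)) (f : Module.End ℤ Fock) (x : Fock) :
    evalSeries (A * PowerSeries.C f) x = evalSeries A (f x) := by
  funext n
  rw [evalSeries, PowerSeries.coeff_mul_C]
  rfl

theorem evalSeries_mul (A A' : PowerSeries (Module.End ℤ Fock)) (x : Fock) (n : ℕ) :
    evalSeries (A * A') x n = ∑ p ∈ Finset.HasAntidiagonal.antidiagonal n,
      PowerSeries.coeff p.1 A (evalSeries A' x p.2) := by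
  simp [evalSeries, PowerSeries.coeff_mul, LinearMap.sum_apply]

theorem evalSeries_mul_congr (A : PowerSeries (Module.End ℤ Fock))
    {A' A'' : PowerSeries (Module.End ℤ Fock)} {x : Fock} (hx : evalSeries A' x = evalSeries A'' x) :
    evalSeries (A * A') x = evalSeries (A * A'') x := by
  funext n
  rw [evalSeries_mul, evalSeries_mul, hx]

theorem evalSeries_mul_of_const (A A' : PowerSeries (Module.End ℤ Fock)) {x v : Fock}
    (hx : evalSeries A' x = constSeries v) :
    evalSeries (A * A') x = evalSeries A v := by
  funext n
  rw [evalSeries_mul, hx, Finset.sum_eq_single (n, 0)]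
  · rfl
  · rintro ⟨i, j⟩ hp hne
    have : j ≠ 0 := by
      rintro rfl
      apply hne
      simpa using hp
    simp [constSeries, this]
  · simp

/-- A map `F → F⟦t⟧` as a series of operators. -/
def operatorSeries (T : Fock →+ (ℕ → Fock)) : PowerSeries (Module.End ℤ Fock) :=
  PowerSeries.mk fun n =>
    AddMonoidHom.toIntLinearMap ((Pi.evalAddMonoidHom (fun _ : ℕ => Fock) n).comp T)

theorem evalSeries_operatorSeries (T : Fock →+ (ℕ → Fock)) (x : Fock) :
    evalSeries (operatorSeries T) x = T x := by
  funext n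
  simp [evalSeries, operatorSeries]

/-- The series of operators through which `p ∈ B[t]` acts. -/
def bosonSeries : B[X] →+* PowerSeries (Module.End ℤ Fock) :=
  (PowerSeries.map bosonAction).comp Polynomial.coeToPowerSeries.ringHom

theorem coeff_bosonSeries (p : B[X]) (n : ℕ) :
    PowerSeries.coeff n (bosonSeries p) = bosonAction (p.coeff n) := by
  simp [bosonSeries]

theorem evalSeries_bosonSeries (p : B[X]) : evalSeries (bosonSeries p) (vac 0) = mulVac p := by
  funext n
  rw [evalSeries, coeff_bosonSeries, mulVac]

/-- The series of operators `∑ c_n (b_{i-n} ∧ ·) t ^ n`. -/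
def wedgeOpSeries (c : ℕ → ℤ) (i : ℤ) : PowerSeries (Module.End ℤ Fock) :=
  PowerSeries.mk fun n => c n • wedgeOp (i - n)

/-- `F` is generated as an abelian group by iterated wedges of `b_i` on the vacuums. -/
theorem fock_wedge_induction {p : Fock → Prop} (hv : ∀ m, p (vac m)) (h0 : p 0)
    (hneg : ∀ x, p x → p (-x)) (hadd : ∀ x y, p x → p y → p (x + y))
    (hw : ∀ i x, p x → p (wedgeOp i x)) (x : Fock) : p x := by
  have hz : ∀ (c : ℤ) (x : Fock), p x → p (c • x) := by
    intro c x hx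
    have hn : ∀ n : ℕ, p (n • x) := by
      intro n
      induction n with
      | zero => rwa [zero_smul]
      | succ n ih => rw [succ_nsmul]; exact hadd _ _ ih hx
    obtain ⟨n, rfl | rfl⟩ := Int.eq_nat_or_neg c
    · rw [natCast_zsmul]; exact hn n
    · rw [neg_smul, natCast_zsmul]; exact hneg _ (hn n)
  have hsmul : ∀ (u : ExtM) (x : Fock), p x → p (u • x) := by
    intro u
    induction u using CliffordAlgebra.left_induction with
    | algebraMap r =>
      intro x hx
      rw [eq_intCast, Int.cast_smul_eq_zsmul]
      exact hz r x hx
    | add u v hu hv =>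
      intro x hx
      rw [add_smul]
      exact hadd _ _ (hu x hx) (hv x hx)
    | ι_mul u y hu =>
      intro x hx
      rw [mul_smul]
      have hux := hu x hx
      change p (ExteriorAlgebra.ι ℤ y • u • x)
      generalize u • x = w at hux
      induction y using Finsupp.induction_linear with
      | zero => rwa [map_zero, zero_smul]
      | add f g hf hg => rw [map_add, add_smul]; exact hadd _ _ hf hg
      | single m c =>
        have h1 : ExteriorAlgebra.ι ℤ (Finsupp.single m c : FreeM) = c • eb m := by
          rw [eb, b, ← map_zsmul]
          simp
        rw [h1, smul_assoc]
        exact hz c _ (hw m w hux)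
  induction x using fock_induction with
  | hv u m => exact hsmul u _ (hv m)
  | hadd x y hx hy => exact hadd x y hx hy

/-! ### Intertwining a derivation of `F` with a ring homomorphism on `B` -/

section Induced

variable {D : ExtM →ₐ[ℤ] PowerSeries ExtM} {c : ℕ → ℤ}
  {hD : ∀ m, constSeries (vac m) = wedgeSeries (D (eb m)) (constSeries (vac (m - 1)))}
  {S : B →+* B[X]}

theorem extendFock_vac (m : ℤ) :
    extendFock D (fun m => constSeries (vac m)) hD (vac m) = constSeries (vac m) := by
  have h1 := extendFock_smul_vac D (fun m => constSeries (vac m)) hD 1 m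
  rw [one_smul, map_one] at h1
  rw [h1]
  funext n
  rw [wedgeSeries_const, PowerSeries.coeff_one, constSeries]
  split_ifs
  · rw [one_smul]
  · rw [zero_smul]

theorem operatorSeries_mul_wedgeOp
    (hc : ∀ j n, PowerSeries.coeff n (D (eb j)) = c n • eb (j - n)) (i : ℤ) :
    operatorSeries (extendFock D (fun m => constSeries (vac m)) hD) * PowerSeries.C (wedgeOp i)
      = wedgeOpSeries c i * operatorSeries (extendFock D (fun m => constSeries (vac m)) hD) := by
  ext n x
  change evalSeries _ x n = evalSeries _ x n
  rw [evalSeries_mul_C, evalSeries_operatorSeries, evalSeries_mul, wedgeOp_apply, extendFock_smul,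
    evalSeries_operatorSeries, wedgeSeries]
  refine Finset.sum_congr rfl fun p _ => ?_
  rw [hc, wedgeOpSeries, PowerSeries.coeff_mk, LinearMap.smul_apply, wedgeOp_apply, smul_assoc]

/-- Each pair of degrees contributes the basic commutation relation with shifted indices, multiplied
by the same product of two `c`'s in all three terms. -/
theorem bosonSeries_mul_wedgeOpSeries (hS : ∀ n j, (S (h n)).coeff j = c j • h (n - j)) (n i : ℤ) :
    bosonSeries (S (h n)) * wedgeOpSeries c i
      = wedgeOpSeries c i * bosonSeries (S (h n))
        + bosonSeries (S (h (n - 1))) * wedgeOpSeries c (i + 1) := by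
  ext1 N
  rw [map_add, PowerSeries.coeff_mul, PowerSeries.coeff_mul, PowerSeries.coeff_mul,
    ← Finset.Nat.sum_antidiagonal_swap (f := fun p => PowerSeries.coeff p.1 (wedgeOpSeries c i) * _),
    ← Finset.sum_add_distrib]
  refine Finset.sum_congr rfl fun p _ => ?_
  simp only [Prod.fst_swap, Prod.snd_swap, coeff_bosonSeries, hS, map_zsmul, wedgeOpSeries,
    PowerSeries.coeff_mk, smul_mul_smul_comm, mul_comm (c p.2)]
  rw [← smul_add, bosonAction_h_mul_wedgeOp, sub_right_comm, sub_add_eq_add_sub]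

/-- Both sides, as functions `X_n` of `n`, satisfy `X_n b_i = (∑ c_k b_{i-k} t^k) X_n + X_{n-1}
b_{i+1}`, vanish for `n < 0` and agree on vacuums. So they agree by induction on the number of wedge
factors, for all `n` at once, and within that on `n`. -/
theorem operatorSeries_mul_bosonAction_h
    (hc : ∀ j n, PowerSeries.coeff n (D (eb j)) = c n • eb (j - n))
    (hS : ∀ n j, (S (h n)).coeff j = c j • h (n - j)) (n : ℤ) :
    operatorSeries (extendFock D (fun m => constSeries (vac m)) hD)
        * PowerSeries.C (bosonAction (h n))
      = bosonSeries (S (h n))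
        * operatorSeries (extendFock D (fun m => constSeries (vac m)) hD) := by
  set T := operatorSeries (extendFock D (fun m => constSeries (vac m)) hD) with hT
  suffices H : ∀ x n, evalSeries (T * PowerSeries.C (bosonAction (h n))) x
      = evalSeries (bosonSeries (S (h n)) * T) x by
    ext N x
    exact congrFun (H x n) N
  intro x
  induction x using fock_wedge_induction with
  | hv m =>
    intro n
    -- Because `T` fixes the vacuums and `h_n[b]_m = b_{m+n} ∧ [b]_{m-1}`, both sides are `∑ c_N
    -- b_{m+n-N} ∧ [b]_{m-1} t^N`.
    rw [evalSeries_mul_C, evalSeries_mul_of_const (v := vac m), hT, evalSeries_operatorSeries,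
      bosonAction_h_vac, extendFock_smul, extendFock_vac]
    · funext N
      rw [wedgeSeries_const, hc, evalSeries, coeff_bosonSeries, hS, map_zsmul,
        LinearMap.smul_apply, bosonAction_h_vac, smul_assoc, add_sub_assoc]
    · rw [hT, evalSeries_operatorSeries, extendFock_vac]
  | h0 => intro n; funext N; simp [evalSeries]
  | hneg x hx =>
    intro n
    funext N
    simpa [evalSeries] using congrFun (hx n) N
  | hadd x y hx hy =>
    intro n
    funext N
    have h1 := congrFun (hx n) N
    have h2 := congrFun (hy n) N
    simp only [evalSeries] at h1 h2 ⊢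
    rw [map_add, map_add, h1, h2]
  | hw i x hx =>
    have hstep : ∀ n i, evalSeries (T * PowerSeries.C (bosonAction (h (n - 1)))) (wedgeOp (i + 1) x)
          = evalSeries (bosonSeries (S (h (n - 1))) * T) (wedgeOp (i + 1) x) →
        evalSeries (T * PowerSeries.C (bosonAction (h n))) (wedgeOp i x)
          = evalSeries (bosonSeries (S (h n)) * T) (wedgeOp i x) := by
      intro n i ih
      have h1 : T * PowerSeries.C (bosonAction (h n)) * PowerSeries.C (wedgeOp i)
          = wedgeOpSeries c i * (T * PowerSeries.C (bosonAction (h n)))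
            + T * PowerSeries.C (bosonAction (h (n - 1))) * PowerSeries.C (wedgeOp (i + 1)) := by
        rw [mul_assoc, ← map_mul, bosonAction_h_mul_wedgeOp, map_add, map_mul, map_mul, mul_add,
          ← mul_assoc, operatorSeries_mul_wedgeOp hc, mul_assoc, mul_assoc]
      have h2 : bosonSeries (S (h n)) * T * PowerSeries.C (wedgeOp i)
          = wedgeOpSeries c i * (bosonSeries (S (h n)) * T)
            + bosonSeries (S (h (n - 1))) * T * PowerSeries.C (wedgeOp (i + 1)) := by
        rw [mul_assoc, operatorSeries_mul_wedgeOp hc, ← mul_assoc,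
          bosonSeries_mul_wedgeOpSeries hS, add_mul, mul_assoc, mul_assoc, mul_assoc,
          operatorSeries_mul_wedgeOp hc]
      rw [← evalSeries_mul_C, ← evalSeries_mul_C, h1, h2, evalSeries_add, evalSeries_add,
        evalSeries_mul_congr _ (hx n), evalSeries_mul_C _ (wedgeOp (i + 1)), ih,
        evalSeries_mul_C _ (wedgeOp (i + 1))]
    have hneg : ∀ n < 0, ∀ i, evalSeries (T * PowerSeries.C (bosonAction (h n))) (wedgeOp i x)
          = evalSeries (bosonSeries (S (h n)) * T) (wedgeOp i x) := by
      intro n hn i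
      rw [h_of_neg hn]
      simp
    intro n
    rcases lt_or_ge n 0 with hn | hn
    · exact hneg n hn i
    · obtain ⟨n, rfl⟩ := Int.eq_ofNat_of_zero_le hn
      clear hn
      -- Lowering `n` by one raises the wedge index `i` by one, so `i` must vary.
      induction n generalizing i with
      | zero => exact hstep _ _ (hneg _ (by simp) _)
      | succ n ih =>
        refine hstep _ _ ?_
        rw [show ((n + 1 : ℕ) : ℤ) - 1 = n by push_cast; ring]
        exact ih (i + 1)

/-- The intertwining relation is additive and multiplicative in `p`, so the case of `h_n` suffices;
applied to `[b]_0`, which `T` fixes, it is the claim. -/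
theorem mulVac_eq_extendFock
    (hc : ∀ j n, PowerSeries.coeff n (D (eb j)) = c n • eb (j - n))
    (hS : ∀ n j, (S (h n)).coeff j = c j • h (n - j)) (p : B) :
    mulVac (S p) = extendFock D (fun m => constSeries (vac m)) hD (bosonAction p (vac 0)) := by
  set T := operatorSeries (extendFock D (fun m => constSeries (vac m)) hD) with hT
  have key : T * PowerSeries.C (bosonAction p) = bosonSeries (S p) * T := by
    induction p using boson_induction with
    | hh n => exact operatorSeries_mul_bosonAction_h hc hS n
    | hint a => simpa using (Int.cast_commute a T).eq.symm
    | hadd f g hf hg => rw [map_add, map_add, map_add, map_add, mul_add, add_mul, hf, hg]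
    | hmul f g hf hg =>
      rw [map_mul, map_mul, map_mul, map_mul, ← mul_assoc, hf, mul_assoc, hg, mul_assoc]
  rw [← evalSeries_bosonSeries, ← evalSeries_operatorSeries, ← evalSeries_mul_C, ← hT, key,
    evalSeries_mul_of_const (v := vac 0)]
  rw [hT, evalSeries_operatorSeries, extendFock_vac]

theorem isInduced_extendFock
    (hc : ∀ j n, PowerSeries.coeff n (D (eb j)) = c n • eb (j - n))
    (hS : ∀ n j, (S (h n)).coeff j = c j • h (n - j)) :
    IsInduced (extendFock D (fun m => constSeries (vac m)) hD) S.toAddMonoidHom.toIntLinearMap :=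
  fun _ lam _ => ⟨mulVac_eq_extendFock hc hS _, by rw [bosonAction_schurDet_vac]⟩

end Induced

/-! ### Uniqueness and the two concrete maps -/

theorem IsInduced.eq {T : Fock →+ (ℕ → Fock)} {S S' : B →ₗ[ℤ] B[X]} (hS : IsInduced T S)
    (hS' : IsInduced T S') : S = S' := by
  refine LinearMap.ext_on span_schurDet ?_
  rintro _ ⟨r, lam, hlam, rfl⟩
  exact mulVac_injective ((hS r lam hlam).1.trans (hS' r lam hlam).1.symm)

theorem isInduced_barHom : IsInduced sigmaBarMinusFock barHom.toAddMonoidHom.toIntLinearMap := by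
  refine isInduced_extendFock (fun j n => ?_) coeff_barHom_h
  rw [coeff_sigmaBarMinus]
  rcases n with _ | _ | n
  · simp
  · simp
  · simp

theorem isInduced_minusHom : IsInduced sigmaMinusFock minusHom.toAddMonoidHom.toIntLinearMap :=
  isInduced_extendFock (c := fun _ => 1) (fun j n => by rw [coeff_sigmaMinus, one_smul])
    fun n j => by rw [coeff_minusHom_h, one_smul]

theorem map_schurDet {R R' : Type*} [CommRing R] [CommRing R'] (f : R →+* R') (a : ℤ → R) {r : ℕ}
    (lam : Fin r → ℕ) : f (schurDet a lam) = schurDet (fun n => f (a n)) lam := by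
  rw [schurDet, RingHom.map_det]
  rfl

theorem isHasseSchmidt_of_h {S : B →+* B[X]} (hS : ∀ n, (S (h n)).coeff 0 = h n) :
    IsHasseSchmidt S.toAddMonoidHom.toIntLinearMap :=
  ⟨map_one S, map_mul S, coeff_zero_eq_self_of_h hS⟩

end SchubertFock

end

theorem mainTheorem6 :
    (∃! S : SchubertFock.B →ₗ[ℤ] Polynomial SchubertFock.B,
      SchubertFock.IsInduced SchubertFock.sigmaBarMinusFock S) ∧
    (∃! S : SchubertFock.B →ₗ[ℤ] Polynomial SchubertFock.B,
      SchubertFock.IsInduced SchubertFock.sigmaMinusFock S) ∧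
    ∀ sigmaBar sigma : SchubertFock.B →ₗ[ℤ] Polynomial SchubertFock.B,
      SchubertFock.IsInduced SchubertFock.sigmaBarMinusFock sigmaBar →
      SchubertFock.IsInduced SchubertFock.sigmaMinusFock sigma →
      (∀ n : ℤ, sigmaBar (SchubertFock.h n)
        = Polynomial.C (SchubertFock.h n)
          - Polynomial.C (SchubertFock.h (n - 1)) * Polynomial.X) ∧
      (∀ n : ℤ, ∀ j : ℕ, (sigma (SchubertFock.h n)).coeff j = SchubertFock.h (n - j)) ∧
      (∀ (r : ℕ) (lam : Fin r → ℕ), Antitone lam →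
        sigmaBar (SchubertFock.schurDet SchubertFock.h lam)
          = SchubertFock.schurDet (fun n => sigmaBar (SchubertFock.h n)) lam) ∧
      (∀ (r : ℕ) (lam : Fin r → ℕ), Antitone lam →
        sigma (SchubertFock.schurDet SchubertFock.h lam)
          = SchubertFock.schurDet (fun n => sigma (SchubertFock.h n)) lam) ∧
      SchubertFock.IsHasseSchmidt sigmaBar ∧ SchubertFock.IsHasseSchmidt sigma := by
  refine ⟨⟨_, SchubertFock.isInduced_barHom, fun S hS => hS.eq SchubertFock.isInduced_barHom⟩,
    ⟨_, SchubertFock.isInduced_minusHom, fun S hS => hS.eq SchubertFock.isInduced_minusHom⟩, ?_⟩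
  intro sigmaBar sigma hbar hminus
  -- By uniqueness the given maps are the explicit ring homomorphisms.
  obtain rfl := hbar.eq SchubertFock.isInduced_barHom
  obtain rfl := hminus.eq SchubertFock.isInduced_minusHom
  exact ⟨SchubertFock.barHom_h, SchubertFock.coeff_minusHom_h,
    fun r lam _ => SchubertFock.map_schurDet SchubertFock.barHom _ lam,
    fun r lam _ => SchubertFock.map_schurDet SchubertFock.minusHom _ lam,
    SchubertFock.isHasseSchmidt_of_h fun n => by simp [SchubertFock.coeff_barHom_h],
    SchubertFock.isHasseSchmidt_of_h fun n => by simp [SchubertFock.coeff_minusHom_h]⟩
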